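/- **Definitions.** For a finite nonempty graph $G$, let $\mathbf{I}(G)$ be the random greedy maximal independent set: the vertices are inspected in a uniformly random order, and a vertex is added if it has no neighbour among the vertices added before it. Let $\iota(G)=|\mathbf{I}(G)|/|V(G)|$. Let $\mathcal{G}_\bullet$ be the space of rooted, locally finite, connected graphs up to rooted isomorphism, with the metric $d_{\mathrm{loc}}((G_1,\rho_1),(G_2,\rho_2))=2^{-R}$, where $R\in\{0,1,2,\dots,\infty\}$ is largest such that the balls $B_{G_1}(\rho_1,R)$ and $B_{G_2}(\rho_2,R)$ are isomorphic as rooted graphs (so the distance is $0$ for isomorphic rooted graphs), and let $(U,\rho)$ be a random element of $\mathcal{G}_\bullet$. Give the vertices of $U$ i.i.d. labels $\sigma_v$, uniform in $[0,1]$. The past $\mathcal{P}_\rho$ of $\rho$ is the set of vertices reachable from $\rho$ by a path along which the labels decrease (including $\rho$). If $\mathcal{P}_\rho$ is almost surely finite, $(U,\rho)$ is said to have nonexplosive growth, and $\iota(U,\rho)=\Pr[\rho\in\mathbf{I}(U[\mathcal{P}_\rho])]$, where the vertices of $\mathcal{P}_\rho$ are inspected in increasing order of their labels. Let $(G_n)$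 be a sequence of (possibly random) finite nonempty graphs with $|V(G_n)|\to\infty$ (in probability, if random). Given $G_n$, let $\rho_n$ be a uniformly random vertex of $G_n$, and let $\mathcal{N}_{G_n}(r)$ be the number of paths of length at most $r$ that start at $\rho_n$. Put $$\mu^*(r)=\lim_{M\to\infty}\limsup_{n\to\infty}\mathbb{E}[\min(\mathcal{N}_{G_n}(r),M)],$$ the expectation being over $G_n$ and $\rho_n$. The sequence has subfactorial path growth if $\mu^*(r)/r!\to0$ as $r\to\infty$. It converges locally to $(U,\rho)$ if for every $r\ge0$ the ball $B_{G_n}(\rho_n,r)$ converges in distribution to $B_U(\rho,r)$; for random $G_n$ this is understood conditionally on $G_n$, in probability, that is, for every $r\ge 0$ and every bounded continuous $f:\mathcal{G}_\bullet\to\mathbb{R}$, $$\mathbb{E}[f(B_{G_n}(\rho_n,r))\mid G_n]\to\mathbb{E}[f(B_U(\rho,r))]\quad\text{in probability.}$$ **Theorem.** If $(G_n)$ has subfactorial path growth and converges locally to $(U,\rho)$, then $(U,\rho)$ has nonexplosive growth, and $\iota(G_n)\sim\iota(U,\rho)$ with high probability: for every $\varepsilon>0$, $$\Pr\big[\,|\iota(G_n)-\iota(U,\rho)|\le\varepsilon\,\iota(U,\rho)\,\big]\to1\qquad(n\to\infty),$$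 the probability being over $G_n$ and the random order of its vertices. -/

import Mathlib

open MeasureTheory Filter Topology
open scoped ENNReal BoundedContinuousFunction

noncomputable section

namespace GreedyMIS

/-! ### Balls in graphs -/

/-- The set of vertices at graph distance at most `r` from `v`. -/
def ballSet {V : Type*} (G : SimpleGraph V) (v : V) (r : ℕ) : Set V :=
  {w | G.edist v w ≤ r}

theorem mem_ballSet_iff {V : Type*} {G : SimpleGraph V} {v w : V} {r : ℕ} :
    w ∈ ballSet G v r ↔ ∃ p : G.Walk v w, p.length ≤ r := by
  constructor
  · intro h
    have h' : G.edist v w ≤ r := h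
    obtain ⟨p, hp⟩ := SimpleGraph.exists_walk_of_edist_ne_top
      (ne_top_of_le_ne_top (ENat.natCast_ne_top r) h')
    refine ⟨p, ?_⟩
    rw [← hp] at h'
    exact_mod_cast h'
  · rintro ⟨p, hp⟩
    exact (SimpleGraph.edist_le p).trans (by exact_mod_cast hp)

theorem self_mem_ballSet {V : Type*} (G : SimpleGraph V) (v : V) (r : ℕ) :
    v ∈ ballSet G v r :=
  mem_ballSet_iff.2 ⟨SimpleGraph.Walk.nil, by simp⟩

theorem walk_support_subset_ballSet {V : Type*} {G : SimpleGraph V} {v w : V} {r : ℕ}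
    (p : G.Walk v w) (hp : p.length ≤ r) : ∀ x ∈ p.support, x ∈ ballSet G v r := by
  classical
  intro x hx
  exact mem_ballSet_iff.2 ⟨p.takeUntil x hx, (p.length_takeUntil_le_length hx).trans hp⟩

/-- A walk of length at most `r` from the centre stays inside the ball of radius `r`. -/
theorem exists_walk_induce {V : Type*} {G : SimpleGraph V} {v w : V} {r R : ℕ} (hrR : r ≤ R)
    (hw : w ∈ ballSet G v R) (p : G.Walk v w) (hp : p.length ≤ r) :
    ∃ q : (G.induce (ballSet G v R)).Walk ⟨v, self_mem_ballSet G v R⟩ ⟨w, hw⟩, q.length ≤ r := by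
  refine ⟨p.induce _ (walk_support_subset_ballSet p (hp.trans hrR)), ?_⟩
  have h : ((p.induce _ (walk_support_subset_ballSet p (hp.trans hrR))).map
    (SimpleGraph.Embedding.induce (ballSet G v R)).toHom).length = p.length := by
    rw [SimpleGraph.Walk.map_induce]
    rfl
  rw [SimpleGraph.Walk.length_map] at h
  omega

theorem ballSet_connected {V : Type*} (G : SimpleGraph V) (v : V) (r : ℕ) :
    (G.induce (ballSet G v r)).Connected := by
  refine SimpleGraph.connected_iff_exists_forall_reachable _ |>.2
    ⟨⟨v, self_mem_ballSet G v r⟩, ?_⟩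
  rintro ⟨w, hw⟩
  obtain ⟨p, hp⟩ := mem_ballSet_iff.1 hw
  obtain ⟨q, -⟩ := exists_walk_induce le_rfl hw p hp
  exact q.reachable

theorem induce_locallyFinite {V : Type*} {G : SimpleGraph V}
    (hG : ∀ w, (G.neighborSet w).Finite) (s : Set V) (w : s) :
    ((G.induce s).neighborSet w).Finite :=
  Set.Finite.preimage (f := ((↑) : s → V)) Subtype.val_injective.injOn (hG w)

/-! ### The space of rooted locally finite connected graphs -/

/-- A rooted locally finite connected graph.  (Such a graph is countable, so every one of them is
isomorphic to one whose vertices form a type in the lowest universe.) -/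
structure RootedGraph where
  /-- the vertices -/
  V : Type
  /-- the edges -/
  graph : SimpleGraph V
  /-- the root -/
  root : V
  connected : graph.Connected
  locallyFinite : ∀ v, (graph.neighborSet v).Finite

/-- The ball of radius `r` around `v`, as a graph rooted at `v`. -/
def ballAt {V : Type} (G : SimpleGraph V) (hG : ∀ w, (G.neighborSet w).Finite) (v : V) (r : ℕ) :
    RootedGraph where
  V := ballSet G v r
  graph := G.induce (ballSet G v r)
  root := ⟨v, self_mem_ballSet G v r⟩
  connected := ballSet_connected G v r
  locallyFinite := induce_locallyFinite hG _

/-- The ball of radius `r` around the root. -/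
def RootedGraph.ball (X : RootedGraph) (r : ℕ) : RootedGraph :=
  ballAt X.graph X.locallyFinite X.root r

/-- Root preserving isomorphism of rooted graphs. -/
def RootedIso (X Y : RootedGraph) : Prop :=
  ∃ e : X.graph ≃g Y.graph, e X.root = Y.root

theorem RootedIso.refl (X : RootedGraph) : RootedIso X X :=
  ⟨SimpleGraph.Iso.refl, rfl⟩

theorem RootedIso.symm {X Y : RootedGraph} (h : RootedIso X Y) : RootedIso Y X := by
  obtain ⟨e, he⟩ := h
  exact ⟨e.symm, by rw [← he]; exact e.symm_apply_apply _⟩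

theorem RootedIso.trans {X Y Z : RootedGraph} (h : RootedIso X Y) (h' : RootedIso Y Z) :
    RootedIso X Z := by
  obtain ⟨e, he⟩ := h
  obtain ⟨f, hf⟩ := h'
  exact ⟨e.trans f, by rw [← hf, ← he]; rfl⟩

/-- Isomorphic rooted graphs have isomorphic balls. -/
theorem RootedIso.ball {X Y : RootedGraph} (h : RootedIso X Y) (r : ℕ) :
    RootedIso (X.ball r) (Y.ball r) := by
  obtain ⟨e, he⟩ := h
  have hmem : ∀ x, x ∈ ballSet X.graph X.root r ↔ e x ∈ ballSet Y.graph Y.root r := by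
    intro x
    rw [mem_ballSet_iff, mem_ballSet_iff]
    constructor
    · rintro ⟨p, hp⟩
      exact ⟨(p.map e.toHom).copy he rfl, by simpa using hp⟩
    · rintro ⟨p, hp⟩
      have h1 : e.symm.toHom Y.root = X.root := by rw [← he]; exact e.symm_apply_apply _
      have h2 : e.symm.toHom (e x) = x := e.symm_apply_apply _
      exact ⟨(p.map e.symm.toHom).copy h1 h2, by simpa using hp⟩
  refine ⟨⟨e.toEquiv.subtypeEquiv hmem, ?_⟩, ?_⟩
  · rintro ⟨a, ha⟩ ⟨b, hb⟩
    exact e.map_adj_iff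
  · exact Subtype.ext he

/-- The ball of radius `r` inside the ball of radius `R ≥ r` is the ball of radius `r`. -/
theorem RootedGraph.ball_ball (X : RootedGraph) {r R : ℕ} (hrR : r ≤ R) :
    RootedIso ((X.ball R).ball r) (X.ball r) := by
  have hmem : ∀ x : (X.ball R).V,
      x ∈ ballSet (X.ball R).graph (X.ball R).root r ↔ x.1 ∈ ballSet X.graph X.root r := by
    intro x
    refine Iff.trans mem_ballSet_iff (Iff.trans ?_ mem_ballSet_iff.symm)
    constructor
    · rintro ⟨p, hp⟩
      exact ⟨p.map (SimpleGraph.Embedding.induce (ballSet X.graph X.root R)).toHom,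
        (SimpleGraph.Walk.length_map _ p).trans_le hp⟩
    · rintro ⟨p, hp⟩
      exact exists_walk_induce hrR x.2 p hp
  have hR : ∀ x, x ∈ ballSet X.graph X.root r → x ∈ ballSet X.graph X.root R := by
    intro x hx
    obtain ⟨p, hp⟩ := mem_ballSet_iff.1 hx
    exact mem_ballSet_iff.2 ⟨p, hp.trans hrR⟩
  refine ⟨⟨⟨fun x => ⟨x.1.1, (hmem x.1).1 x.2⟩,
    fun x => ⟨⟨x.1, hR x.1 x.2⟩, (hmem ⟨x.1, hR x.1 x.2⟩).2 x.2⟩,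
    fun x => rfl, fun x => rfl⟩, ?_⟩, rfl⟩
  intro a b
  exact Iff.rfl

theorem RootedIso.ball_mono {X Y : RootedGraph} {r R : ℕ} (hrR : r ≤ R)
    (h : RootedIso (X.ball R) (Y.ball R)) : RootedIso (X.ball r) (Y.ball r) :=
  ((X.ball_ball hrR).symm.trans (h.ball r)).trans (Y.ball_ball hrR)

theorem RootedIso.ball_zero (X Y : RootedGraph) : RootedIso (X.ball 0) (Y.ball 0) := by
  have key : ∀ (Z : RootedGraph) (a : (Z.ball 0).V), a = (Z.ball 0).root := by
    rintro Z ⟨a, ha⟩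
    obtain ⟨p, hp⟩ := mem_ballSet_iff.1 ha
    exact Subtype.ext (SimpleGraph.Walk.eq_of_length_eq_zero (Nat.le_zero.1 hp)).symm
  refine ⟨⟨⟨fun _ => (Y.ball 0).root, fun _ => (X.ball 0).root,
    fun a => (key X a).symm, fun a => (key Y a).symm⟩, ?_⟩, rfl⟩
  intro a b
  rw [key X a, key X b]
  exact iff_of_false (SimpleGraph.irrefl _) (SimpleGraph.irrefl _)

/-- The local distance `2 ^ (-R)`, where `R` is the largest radius at which the balls around the
roots are isomorphic as rooted graphs; it is `0` if they are isomorphic at all radii. -/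
def dloc (X Y : RootedGraph) : ℝ :=
  ⨅ R : {R : ℕ // RootedIso (X.ball R) (Y.ball R)}, (1 / 2 : ℝ) ^ R.1

/-- The (pseudo)metric of local convergence.  Isomorphic rooted graphs are at distance `0`, so
continuous functions and Borel sets only depend on graphs up to rooted isomorphism: this is the
usual metric on the set of isomorphism classes, pulled back to their representatives. -/
instance : PseudoMetricSpace RootedGraph where
  dist := dloc
  dist_self X := by
    have hbdd : BddBelow (Set.range fun R : {R : ℕ // RootedIso (X.ball R) (X.ball R)} =>
      (1 / 2 : ℝ) ^ R.1) := ⟨0, by rintro _ ⟨R, rfl⟩; positivity⟩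
    refine le_antisymm ?_ (Real.iInf_nonneg fun R => by positivity)
    refine ge_of_tendsto' (tendsto_pow_atTop_nhds_zero_of_lt_one
      (by norm_num : (0 : ℝ) ≤ 1 / 2) (by norm_num)) fun n => ?_
    exact ciInf_le hbdd ⟨n, RootedIso.refl _⟩
  dist_comm X Y := by
    have h : ∀ X Y : RootedGraph, dloc X Y ≤ dloc Y X := by
      intro X Y
      have : Nonempty {R : ℕ // RootedIso (Y.ball R) (X.ball R)} := ⟨⟨0, RootedIso.ball_zero _ _⟩⟩
      refine le_ciInf fun R => ?_
      exact ciInf_le (f := fun R : {R : ℕ // RootedIso (X.ball R) (Y.ball R)} =>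
        (1 / 2 : ℝ) ^ R.1) ⟨0, by rintro _ ⟨R, rfl⟩; positivity⟩ ⟨R.1, R.2.symm⟩
    exact le_antisymm (h X Y) (h Y X)
  dist_triangle X Y Z := by
    have : Nonempty {R : ℕ // RootedIso (X.ball R) (Y.ball R)} := ⟨⟨0, RootedIso.ball_zero _ _⟩⟩
    have : Nonempty {R : ℕ // RootedIso (Y.ball R) (Z.ball R)} := ⟨⟨0, RootedIso.ball_zero _ _⟩⟩
    refine le_ciInf_add_ciInf fun R S => ?_
    have hmin : RootedIso (X.ball (min R.1 S.1)) (Z.ball (min R.1 S.1)) :=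
      (R.2.ball_mono (min_le_left _ _)).trans (S.2.ball_mono (min_le_right _ _))
    refine (ciInf_le (f := fun R : {R : ℕ // RootedIso (X.ball R) (Z.ball R)} =>
        (1 / 2 : ℝ) ^ R.1) ⟨0, by rintro _ ⟨R, rfl⟩; positivity⟩ ⟨_, hmin⟩).trans ?_
    have h1 : (0 : ℝ) < (1 / 2 : ℝ) ^ R.1 := by positivity
    have h2 : (0 : ℝ) < (1 / 2 : ℝ) ^ S.1 := by positivity
    rcases min_choice R.1 S.1 with h | h <;> simp only [h] <;> linarith

instance : MeasurableSpace RootedGraph := borel RootedGraph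

instance : BorelSpace RootedGraph := ⟨rfl⟩

/-! ### Random finite graphs -/

/-- Nonempty finite graphs, up to naming the `m + 1` vertices `0, …, m`.  This type is countable,
and a random finite graph is given by its law, a `PMF FinGraph`. -/
abbrev FinGraph : Type := Σ m : ℕ, SimpleGraph (Fin (m + 1))

/-- The number of vertices. -/
def FinGraph.order (G : FinGraph) : ℕ := G.1 + 1

/-- The ball of radius `r` around the vertex `v` of a finite graph. -/
def FinGraph.ball (G : FinGraph) (v : Fin (G.1 + 1)) (r : ℕ) : RootedGraph :=
  ballAt G.2 (fun _ => Set.toFinite _) v r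

/-- `E[f(B_G(v, r))]` for a fixed finite graph `G` and a uniformly random vertex `v` of it. -/
def FinGraph.ballMean (G : FinGraph) (r : ℕ) (f : RootedGraph → ℝ) : ℝ :=
  (∑ v : Fin (G.1 + 1), f (G.ball v r)) / (G.order : ℝ)

/-- Local convergence of a sequence of random finite graphs to a random rooted graph with law `U`:
for every `r`, the law of the ball of radius `r` around a uniformly random vertex of `Gₙ` (the
vertex being random, `Gₙ` being given) converges weakly, in probability with respect to `Gₙ`, to
the law of the ball of radius `r` around the root.  If every `Gₙ` is deterministic, this says that
the ball around a uniformly random vertex converges in distribution. -/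
def ConvergesLocally (G : ℕ → PMF FinGraph) (U : Measure RootedGraph) : Prop :=
  ∀ (r : ℕ) (f : RootedGraph →ᵇ ℝ) (ε : ℝ), 0 < ε →
    Tendsto (fun n => (G n).toOuterMeasure
      {H | ε < |H.ballMean r f - ∫ X, f (X.ball r) ∂U|}) atTop (𝓝 0)

/-- The number of vertices tends to infinity in probability. -/
def OrderTendsto (G : ℕ → PMF FinGraph) : Prop :=
  ∀ k : ℕ, Tendsto (fun n => (G n).toOuterMeasure {H | H.order ≤ k}) atTop (𝓝 0)

/-! ### Path growth -/

/-- The number of paths of length at most `r` that start at `v`. -/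
def pathCount {V : Type*} (G : SimpleGraph V) (v : V) (r : ℕ) : ℕ∞ :=
  Set.encard {p : Σ w, G.Walk v w | p.2.IsPath ∧ p.2.length ≤ r}

/-- `E[min(N(r), M)]`, where `N(r)` is the number of paths of length at most `r` that start at a
uniformly random vertex of the random finite graph with law `P`. -/
def truncPathMean (P : PMF FinGraph) (r M : ℕ) : ℝ≥0∞ :=
  ∑' H : FinGraph, P H *
    ((∑ v : Fin (H.1 + 1), ((min (pathCount H.2 v r) (M : ℕ∞) : ℕ∞) : ℝ≥0∞)) / (H.order : ℝ≥0∞))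

/-- `lim_{M → ∞} limsup_{n → ∞} E[min(N_{Gₙ}(r), M)]`; the limit is that of a monotone function of
`M`, hence a supremum. -/
def muStar (G : ℕ → PMF FinGraph) (r : ℕ) : ℝ≥0∞ :=
  ⨆ M : ℕ, limsup (fun n => truncPathMean (G n) r M) atTop

theorem tendsto_muStar (G : ℕ → PMF FinGraph) (r : ℕ) :
    Tendsto (fun M : ℕ => limsup (fun n => truncPathMean (G n) r M) atTop) atTop
      (𝓝 (muStar G r)) := by
  refine tendsto_atTop_iSup fun M N hMN => ?_
  refine limsup_le_limsup (Eventually.of_forall fun n => ?_)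
  refine ENNReal.tsum_le_tsum fun H => ?_
  have h : (M : ℕ∞) ≤ N := by exact_mod_cast hMN
  gcongr

/-- Subfactorial path growth. -/
def SubfactorialPathGrowth (G : ℕ → PMF FinGraph) : Prop :=
  Tendsto (fun r : ℕ => muStar G r / (r.factorial : ℝ≥0∞)) atTop (𝓝 0)

/-! ### The greedy maximal independent set -/

open Classical in
/-- The greedy independent set: inspect the vertices in the order of the list, and add a vertex if
it has no neighbour among the vertices added so far. -/
def greedySet {V : Type*} (G : SimpleGraph V) (l : List V) : Finset V :=
  l.foldl (fun I v => if ∀ w ∈ I, ¬ G.Adj v w then insert v I else I) ∅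

/-- The density of the greedy independent set of a finite graph, the vertices being inspected in
the order `π 0, π 1, …, π m`. -/
def greedyRatio (G : FinGraph) (π : Equiv.Perm (Fin (G.1 + 1))) : ℝ :=
  ((greedySet G.2 (List.ofFn π)).card : ℝ) / (G.order : ℝ)

/-- The law of the greedy independence ratio of a random finite graph, the vertices being inspected
in a uniformly random order. -/
def greedyRatioLaw (P : PMF FinGraph) : PMF ℝ :=
  P.bind fun G => (PMF.uniformOfFintype (Equiv.Perm (Fin (G.1 + 1)))).map (greedyRatio G)

/-- The law of independent labels, one for every vertex, uniform in `[0, 1]`. -/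
def labelLaw (V : Type*) : Measure (V → unitInterval) :=
  Measure.infinitePi fun _ => (volume : Measure unitInterval)

/-- The past of `v`: the vertices that are reachable from `v` by a path with decreasing labels. -/
def past {V : Type*} (G : SimpleGraph V) (σ : V → unitInterval) (v : V) : Set V :=
  {w | Relation.ReflTransGen (fun a b => G.Adj a b ∧ σ b < σ a) v w}

/-- The past of the root is almost surely finite. -/
def NonexplosiveGrowth (U : Measure RootedGraph) : Prop :=
  ∀ᵐ X ∂U, ∀ᵐ σ ∂(labelLaw X.V), (past X.graph σ X.root).Finite

/-- The past of the root is finite, and the root belongs to the greedy independent set of the graph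
induced on its past, whose vertices are inspected in increasing order of their labels. -/
def RootOccupied (X : RootedGraph) (σ : X.V → unitInterval) : Prop :=
  ∃ l : List (past X.graph σ X.root), (∀ v, v ∈ l) ∧ l.Pairwise (fun a b => σ a.1 < σ b.1) ∧
    ⟨X.root, Relation.ReflTransGen.refl⟩ ∈ greedySet (X.graph.induce (past X.graph σ X.root)) l

/-- The probability `ι(U, ρ)` that the root is in the greedy independent set of its past. -/
def rootDensity (U : Measure RootedGraph) : ℝ :=
  (∫⁻ X, labelLaw X.V {σ | RootOccupied X σ} ∂U).toReal

end GreedyMIS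

end

/-!
The greedy set is described by independent uniform labels: a vertex is in it iff no neighbour with
a smaller label is.  Unfolding this recursion to depth `r` gives a rule that only looks at the ball
of radius `r`, and whose answer is correct unless a decreasing path of length `r` starts at the
vertex.  A given path of length `r` decreases with probability `1 / (r + 1)!`, so subfactorial path
growth makes the probability of such a path small as `r → ∞`; in the limit graph this says that the
past of the root is almost surely finite.

For fixed `r`, whether the cut-off rule accepts a vertex and whether a decreasing path of length `r`
starts there are events determined by a labelled ball.  Two such events are independent if the balls
are disjoint, and balls are bounded except at a small proportion of the vertices, so Chebyshev's
inequality yields a law of large numbers for the frequencies of both events.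
-/

noncomputable section

namespace GreedyMIS

section Labels

instance (V : Type*) : IsProbabilityMeasure (labelLaw V) := by
  unfold labelLaw; infer_instance

variable {V W : Type*}

theorem iIndepFun_label (V : Type*) :
    ProbabilityTheory.iIndepFun (fun v (σ : V → unitInterval) => σ v) (labelLaw V) :=
  ProbabilityTheory.iIndepFun_infinitePi (X := fun _ x => x) fun _ => measurable_id

theorem labelLaw_map_eval (v : V) : (labelLaw V).map (fun σ => σ v) = volume :=
  Measure.infinitePi_map_eval _ v

theorem labelLaw_map_comp (q : W → V) (hq : Function.Injective q) :
    (labelLaw V).map (· ∘ q) = labelLaw W := by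
  have h := ((iIndepFun_label V).precomp hq).map_fun_eq_infinitePi_map fun w =>
    measurable_pi_apply (q w)
  simp only [labelLaw_map_eval] at h
  exact h

theorem measurePreserving_comp_label (q : W → V) (hq : Function.Injective q) :
    MeasurePreserving (· ∘ q) (labelLaw V) (labelLaw W) :=
  ⟨measurable_pi_lambda _ fun w => measurable_pi_apply (q w), labelLaw_map_comp q hq⟩

theorem labelLaw_label_eq {v w : V} (hvw : v ≠ w) : labelLaw V {σ | σ v = σ w} = 0 := by
  have hmeas : Measurable fun σ : V → unitInterval => (σ v, σ w) :=
    (measurable_pi_apply v).prodMk (measurable_pi_apply w)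
  have hjoint : (labelLaw V).map (fun σ => (σ v, σ w)) = volume.prod volume := by
    rw [(ProbabilityTheory.indepFun_iff_map_prod_eq_prod_map_map
      (measurable_pi_apply v).aemeasurable (measurable_pi_apply w).aemeasurable).1
      ((iIndepFun_label V).indepFun hvw), labelLaw_map_eval, labelLaw_map_eval]
  have hdiag : MeasurableSet (Set.diagonal unitInterval) := measurableSet_diagonal
  calc labelLaw V {σ | σ v = σ w}
      = (labelLaw V).map (fun σ => (σ v, σ w)) (Set.diagonal unitInterval) :=
        (Measure.map_apply hmeas hdiag).symm
    _ = 0 := by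
        rw [hjoint, Measure.measure_prod_null hdiag]
        refine Eventually.of_forall fun x => ?_
        simp [show Prod.mk x ⁻¹' Set.diagonal unitInterval = {x} by ext y; simp [eq_comm]]

theorem ae_injective_label (V : Type*) [Countable V] :
    ∀ᵐ σ ∂(labelLaw V), Function.Injective σ := by
  have hne : ∀ᵐ σ ∂(labelLaw V), ∀ v w : V, v ≠ w → σ v ≠ σ w :=
    ae_all_iff.2 fun v => ae_all_iff.2 fun w => eventually_imp_distrib_left.2 fun hvw =>
      measure_eq_zero_iff_ae_notMem.1 (labelLaw_label_eq hvw)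
  filter_upwards [hne] with σ hσ v w hvw
  exact not_imp_not.1 (hσ v w) hvw

theorem measurableSet_strictMono_comp {n : ℕ} (q : Fin n → V) :
    MeasurableSet {σ : V → unitInterval | StrictMono (σ ∘ q)} := by
  have : {σ : V → unitInterval | StrictMono (σ ∘ q)} =
      ⋂ i, ⋂ j, ⋂ (_ : i < j), {σ | σ (q i) < σ (q j)} := by
    ext σ; simp [StrictMono]
  rw [this]
  exact MeasurableSet.iInter fun i => MeasurableSet.iInter fun j => MeasurableSet.iInter fun _ =>
    measurableSet_lt (measurable_pi_apply _) (measurable_pi_apply _)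

theorem disjoint_strictMono_comp {n : ℕ} :
    Pairwise (Function.onFun Disjoint
      fun π : Equiv.Perm (Fin n) => {σ : Fin n → unitInterval | StrictMono (σ ∘ π)}) := by
  intro π τ hne
  refine Set.disjoint_left.2 fun σ hπ hτ => hne ?_
  have hrange : Set.range (σ ∘ π) = Set.range (σ ∘ τ) := by
    rw [Set.range_comp, Set.range_comp, π.range_eq_univ, τ.range_eq_univ]
  have heq : σ ∘ π = σ ∘ τ := (StrictMono.range_inj hπ hτ).1 hrange
  have hinj : Function.Injective σ := (π.injective_comp σ).1 hπ.injective
  exact Equiv.ext fun i => hinj (congrFun heq i)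

theorem labelLaw_strictMono_comp_perm {n : ℕ} (π : Equiv.Perm (Fin n)) :
    labelLaw (Fin n) {σ | StrictMono (σ ∘ π)} = (n.factorial : ℝ≥0∞)⁻¹ := by
  have hconst : ∀ τ : Equiv.Perm (Fin n), labelLaw (Fin n) {σ | StrictMono (σ ∘ τ)} =
      labelLaw (Fin n) {σ | StrictMono σ} := fun τ =>
    (measurePreserving_comp_label τ τ.injective).measure_preimage
      (measurableSet_strictMono_comp id).nullMeasurableSet
  have hcover : ∀ᵐ σ ∂(labelLaw (Fin n)),
      σ ∈ ⋃ τ : Equiv.Perm (Fin n), {σ | StrictMono (σ ∘ τ)} := by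
    filter_upwards [ae_injective_label (Fin n)] with σ hσ
    exact Set.mem_iUnion.2 ⟨Tuple.sort σ,
      (Tuple.monotone_sort σ).strictMono_of_injective (hσ.comp (Tuple.sort σ).injective)⟩
  have hsum : ∑ τ : Equiv.Perm (Fin n), labelLaw (Fin n) {σ | StrictMono (σ ∘ τ)} = 1 := by
    rw [← tsum_fintype (L := .unconditional _), ← measure_iUnion disjoint_strictMono_comp
      fun τ => measurableSet_strictMono_comp τ]
    exact (mem_ae_iff_prob_eq_one (MeasurableSet.iUnion
      fun τ : Equiv.Perm (Fin n) => measurableSet_strictMono_comp τ)).1 hcover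
  rw [Finset.sum_congr rfl fun τ _ => hconst τ, Finset.sum_const, Finset.card_univ,
    Fintype.card_perm, Fintype.card_fin, nsmul_eq_mul] at hsum
  rw [hconst]
  exact ENNReal.eq_inv_of_mul_eq_one_left (by rwa [mul_comm] at hsum)

theorem uniformOfFintype_perm_apply {n : ℕ} (S : Set (Equiv.Perm (Fin n))) :
    (PMF.uniformOfFintype (Equiv.Perm (Fin n))).toOuterMeasure S =
      labelLaw (Fin n) {σ | ∃ π ∈ S, StrictMono (σ ∘ π)} := by
  classical
  have hunion : {σ : Fin n → unitInterval | ∃ π ∈ S, StrictMono (σ ∘ π)} =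
      ⋃ π : S, {σ | StrictMono (σ ∘ π.1)} := by
    ext σ; simp
  have hdisj : Pairwise (Function.onFun Disjoint
      fun π : S => {σ : Fin n → unitInterval | StrictMono (σ ∘ π.1)}) :=
    disjoint_strictMono_comp.comp_of_injective Subtype.val_injective
  rw [PMF.toOuterMeasure_uniformOfFintype_apply, Fintype.card_perm, Fintype.card_fin, hunion,
    measure_iUnion hdisj fun π => measurableSet_strictMono_comp _, tsum_fintype]
  simp only [labelLaw_strictMono_comp_perm, Finset.sum_const, Finset.card_univ, nsmul_eq_mul,
    div_eq_mul_inv]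

theorem labelLaw_strictMono_comp {n : ℕ} (q : Fin n → V) (hq : Function.Injective q) :
    labelLaw V {σ | StrictMono (σ ∘ q)} = (n.factorial : ℝ≥0∞)⁻¹ := by
  rw [← labelLaw_strictMono_comp_perm 1]
  exact (measurePreserving_comp_label q hq).measure_preimage
    (measurableSet_strictMono_comp _).nullMeasurableSet

theorem labelLaw_pairwise_gt {l : List V} (hl : l.Nodup) :
    labelLaw V {σ | l.Pairwise fun a b => σ b < σ a} = (l.length.factorial : ℝ≥0∞)⁻¹ := by
  rw [← labelLaw_strictMono_comp _ ((List.nodup_iff_injective_get.1 hl).comp Fin.rev_injective)]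
  congr 1
  ext σ
  simp only [Set.mem_ofPred_eq, List.pairwise_iff_get]
  constructor
  · intro h i j hij
    exact h _ _ (Fin.rev_lt_rev.2 hij)
  · intro h i j hij
    simpa only [Function.comp_apply, Fin.rev_rev] using h (Fin.rev_lt_rev.2 hij)

end Labels

section Balls

variable {V W : Type*} {G : SimpleGraph V} {H : SimpleGraph W} {σ : V → unitInterval} {v w : V}
  {k r : ℕ}

theorem ballSet_zero (G : SimpleGraph V) (v : V) : ballSet G v 0 = {v} := by
  ext x
  simp [ballSet, eq_comm (a := x)]

theorem mem_ballSet_succ {x : V} :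
    x ∈ ballSet G v (r + 1) ↔ x = v ∨ ∃ w, G.Adj v w ∧ x ∈ ballSet G w r := by
  rw [mem_ballSet_iff]
  constructor
  · rintro ⟨_ | ⟨hvw, p⟩, hp⟩
    · exact .inl rfl
    · exact .inr ⟨_, hvw, mem_ballSet_iff.2 ⟨p, Nat.le_of_succ_le_succ hp⟩⟩
  · rintro (rfl | ⟨w, hvw, hx⟩)
    · exact ⟨.nil, Nat.zero_le _⟩
    · obtain ⟨p, hp⟩ := mem_ballSet_iff.1 hx
      exact ⟨.cons hvw p, Nat.succ_le_succ hp⟩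

theorem ballSet_subset_of_adj (h : G.Adj v w) (r : ℕ) : ballSet G w r ⊆ ballSet G v (r + 1) :=
  fun _ hx => mem_ballSet_succ.2 (.inr ⟨w, h, hx⟩)

theorem mem_ballSet_of_adj (h : G.Adj v w) : w ∈ ballSet G v (r + 1) :=
  ballSet_subset_of_adj h r (self_mem_ballSet G w r)

theorem ballSet_finite (hG : ∀ w, (G.neighborSet w).Finite) (v : V) (r : ℕ) :
    (ballSet G v r).Finite := by
  induction r generalizing v with
  | zero => rw [ballSet_zero]; exact Set.finite_singleton v
  | succ r ih =>
    refine (((hG v).biUnion fun w _ => ih w).insert v).subset fun x hx => ?_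
    simpa only [Set.mem_insert_iff, Set.mem_iUnion, SimpleGraph.mem_neighborSet, exists_prop]
      using mem_ballSet_succ.1 hx

theorem image_ballSet (f : G ↪g H) (hf : ballSet H (f v) r ⊆ Set.range f) :
    f '' ballSet G v r = ballSet H (f v) r := by
  induction r generalizing v with
  | zero => rw [ballSet_zero, ballSet_zero, Set.image_singleton]
  | succ r ih =>
    have ih' : ∀ w, G.Adj v w → f '' ballSet G w r = ballSet H (f w) r := fun w hvw =>
      ih ((ballSet_subset_of_adj (f.map_adj_iff.2 hvw) r).trans hf)
    ext y
    rw [mem_ballSet_succ]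
    constructor
    · rintro ⟨x, hx, rfl⟩
      rcases mem_ballSet_succ.1 hx with rfl | ⟨w, hvw, hxw⟩
      · exact .inl rfl
      · exact .inr ⟨f w, f.map_adj_iff.2 hvw, ih' w hvw ▸ Set.mem_image_of_mem f hxw⟩
    · rintro (rfl | ⟨w', hvw, hy⟩)
      · exact Set.mem_image_of_mem f (self_mem_ballSet G v _)
      · obtain ⟨w, rfl⟩ := hf (mem_ballSet_of_adj hvw)
        have hvw' : G.Adj v w := f.map_adj_iff.1 hvw
        rw [← ih' w hvw'] at hy
        exact Set.image_mono (ballSet_subset_of_adj hvw' r) hy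

instance (X : RootedGraph) : Countable X.V := by
  have hcover : Set.univ ⊆ ⋃ r, ballSet X.graph X.root r := fun v _ => by
    obtain ⟨p⟩ := X.connected.preconnected X.root v
    exact Set.mem_iUnion.2 ⟨p.length, mem_ballSet_iff.2 ⟨p, le_rfl⟩⟩
  exact Set.countable_univ_iff.1 <|
    (Set.countable_iUnion fun r => (ballSet_finite X.locallyFinite X.root r).countable).mono hcover

theorem past_subset_of_adj (hvw : G.Adj v w) (hσ : σ w < σ v) : past G σ w ⊆ past G σ v :=
  fun _ hx => hx.head ⟨hvw, hσ⟩

theorem mem_past_of_adj (hvw : G.Adj v w) (hσ : σ w < σ v) : w ∈ past G σ v :=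
  .single ⟨hvw, hσ⟩

end Balls

section LocalRules

variable {V W : Type*} {G : SimpleGraph V} {H : SimpleGraph W} {k : ℕ}

/-- There is a path of length `k` from `v` along which the labels decrease. -/
def HasDecreasingPath (G : SimpleGraph V) (σ : V → unitInterval) : ℕ → V → Prop
  | 0, _ => True
  | k + 1, v => ∃ w, G.Adj v w ∧ σ w < σ v ∧ HasDecreasingPath G σ k w

/-- The recursive form of the greedy rule, cut off at depth `k`: a vertex is occupied if no
neighbour with a smaller label is, every vertex being declared occupied at depth `0`.  The cutoff
makes the rule local; it is harmless at vertices without a decreasing path of length `k`. -/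
def Occupied (G : SimpleGraph V) (σ : V → unitInterval) : ℕ → V → Prop
  | 0, _ => True
  | k + 1, v => ∀ w, G.Adj v w → σ w < σ v → ¬ Occupied G σ k w

theorem HasDecreasingPath.of_succ {σ : V → unitInterval} {v : V}
    (h : HasDecreasingPath G σ (k + 1) v) : HasDecreasingPath G σ k v := by
  induction k generalizing v with
  | zero => trivial
  | succ k ih =>
    obtain ⟨w, hvw, hσ, hw⟩ := h
    exact ⟨w, hvw, hσ, ih hw⟩

theorem measurableSet_hasDecreasingPath [Countable V] (G : SimpleGraph V) (k : ℕ) (v : V) :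
    MeasurableSet {σ | HasDecreasingPath G σ k v} := by
  induction k generalizing v with
  | zero => exact MeasurableSet.univ
  | succ k ih =>
    exact measurableSet_setOfPred.2 <| .exists fun w => measurable_const.and <|
      (measurableSet_setOfPred.1 (measurableSet_lt (measurable_pi_apply w)
        (measurable_pi_apply v))).and (measurableSet_setOfPred.1 (ih w))

theorem measurableSet_occupied [Countable V] (G : SimpleGraph V) (k : ℕ) (v : V) :
    MeasurableSet {σ | Occupied G σ k v} := by
  induction k generalizing v with
  | zero => exact MeasurableSet.univ
  | succ k ih =>
    exact measurableSet_setOfPred.2 <| .forall fun w => measurable_const.imp <|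
      (measurableSet_setOfPred.1 (measurableSet_lt (measurable_pi_apply w)
        (measurable_pi_apply v))).imp (measurableSet_setOfPred.1 (ih w)).not

theorem ballSet_inter_past_subset_of_adj {σ : V → unitInterval} {v w : V} (hvw : G.Adj v w)
    (hσ : σ w < σ v) (k : ℕ) :
    ballSet G w k ∩ past G σ w ⊆ ballSet G v (k + 1) ∩ past G σ v :=
  Set.inter_subset_inter (ballSet_subset_of_adj hvw k) (past_subset_of_adj hvw hσ)

theorem hasDecreasingPath_comp_iff (f : G ↪g H) {σ : W → unitInterval} {v : V}
    (hf : ballSet H (f v) k ∩ past H σ (f v) ⊆ Set.range f) :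
    HasDecreasingPath G (σ ∘ f) k v ↔ HasDecreasingPath H σ k (f v) := by
  induction k generalizing v with
  | zero => exact Iff.rfl
  | succ k ih =>
    have ih' : ∀ w, H.Adj (f v) (f w) → σ (f w) < σ (f v) →
        (HasDecreasingPath G (σ ∘ f) k w ↔ HasDecreasingPath H σ k (f w)) := fun w hvw hσ =>
      ih ((ballSet_inter_past_subset_of_adj hvw hσ k).trans hf)
    constructor
    · rintro ⟨w, hvw, hσ, h⟩
      have hvw' := f.map_adj_iff.2 hvw
      exact ⟨f w, hvw', hσ, (ih' w hvw' hσ).1 h⟩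
    · rintro ⟨w, hvw, hσ, h⟩
      obtain ⟨w, rfl⟩ := hf ⟨mem_ballSet_of_adj hvw, mem_past_of_adj hvw hσ⟩
      exact ⟨w, f.map_adj_iff.1 hvw, hσ, (ih' w hvw hσ).2 h⟩

theorem occupied_comp_iff (f : G ↪g H) {σ : W → unitInterval} {v : V}
    (hf : ballSet H (f v) k ∩ past H σ (f v) ⊆ Set.range f) :
    Occupied G (σ ∘ f) k v ↔ Occupied H σ k (f v) := by
  induction k generalizing v with
  | zero => exact Iff.rfl
  | succ k ih =>
    have ih' : ∀ w, H.Adj (f v) (f w) → σ (f w) < σ (f v) →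
        (Occupied G (σ ∘ f) k w ↔ Occupied H σ k (f w)) := fun w hvw hσ =>
      ih ((ballSet_inter_past_subset_of_adj hvw hσ k).trans hf)
    constructor
    · intro h w hvw hσ ho
      obtain ⟨w, rfl⟩ := hf ⟨mem_ballSet_of_adj hvw, mem_past_of_adj hvw hσ⟩
      exact h w (f.map_adj_iff.1 hvw) hσ ((ih' w hvw hσ).2 ho)
    · intro h w hvw hσ ho
      have hvw' := f.map_adj_iff.2 hvw
      exact h (f w) hvw' hσ ((ih' w hvw' hσ).1 ho)

end LocalRules

section LocalEvents

theorem FinGraph.order_cast_pos (H : FinGraph) : (0 : ℝ) < H.order :=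
  Nat.cast_pos.2 H.1.succ_pos

theorem rootedIso_ball_of_dist_lt {X Y : RootedGraph} {k : ℕ} (h : dist X Y < (1 / 2 : ℝ) ^ k) :
    RootedIso (X.ball k) (Y.ball k) := by
  have : Nonempty {R : ℕ // RootedIso (X.ball R) (Y.ball R)} := ⟨⟨0, RootedIso.ball_zero _ _⟩⟩
  obtain ⟨⟨R, hR⟩, hlt⟩ := exists_lt_of_ciInf_lt h
  have hkR : k < R := (pow_lt_pow_iff_right_of_lt_one₀ (by norm_num) (by norm_num)).1 hlt
  exact hR.ball_mono hkR.le

/-- An event attached to a labelled rooted graph that is determined by the ball of radius `r` around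
the root, with its labels.  Both locality and invariance under isomorphism are expressed by the
invariance under embeddings whose range contains that ball. -/
structure LocalEvent (r : ℕ) where
  /-- the event holds at the given vertex of the given labelled graph -/
  Holds : ∀ {V : Type}, SimpleGraph V → (V → unitInterval) → V → Prop
  measurableSet_holds : ∀ {V : Type} [Countable V] (G : SimpleGraph V) (v : V),
    MeasurableSet {σ | Holds G σ v}
  holds_comp_iff : ∀ {V W : Type} {G : SimpleGraph V} {H : SimpleGraph W} (f : G ↪g H)
    (σ : W → unitInterval) (v : V), ballSet H (f v) r ⊆ Set.range f →
    (Holds G (σ ∘ f) v ↔ Holds H σ (f v))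

/-- The event that a decreasing path of length `r` starts at the root. -/
def decreasingPathEvent (r : ℕ) : LocalEvent r where
  Holds G σ v := HasDecreasingPath G σ r v
  measurableSet_holds G v := measurableSet_hasDecreasingPath G r v
  holds_comp_iff f _ _ hf := hasDecreasingPath_comp_iff f (Set.inter_subset_left.trans hf)

/-- The event that the root is occupied according to the greedy rule cut off at depth `r`. -/
def occupiedEvent (r : ℕ) : LocalEvent r where
  Holds G σ v := Occupied G σ r v
  measurableSet_holds G v := measurableSet_occupied G r v
  holds_comp_iff f _ _ hf := occupied_comp_iff f (Set.inter_subset_left.trans hf)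

/-- The (deterministic) event that the ball of radius `r` around the root has more than `K`
vertices.  In graphs that need not be locally finite, infinite balls are not counted as large. -/
def largeBallEvent (r K : ℕ) : LocalEvent r where
  Holds G _ v := K < (ballSet G v r).ncard
  measurableSet_holds _ _ := MeasurableSet.const _
  holds_comp_iff f _ _ hf := by
    rw [← image_ballSet f hf, Set.ncard_image_of_injective _ f.injective]

namespace LocalEvent

variable {r : ℕ} (E : LocalEvent r)

/-- The probability of a local event at the vertex `v` of `G`. -/
def prob {V : Type} (G : SimpleGraph V) (v : V) : ℝ :=
  (labelLaw V).real {σ | E.Holds G σ v}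

/-- The probability of a local event at the root of a random rooted graph. -/
def limitProb (U : Measure RootedGraph) : ℝ :=
  ∫ X, E.prob X.graph X.root ∂U

/-- The probability of a local event at a uniformly random vertex of a finite graph. -/
def meanProb (H : FinGraph) : ℝ :=
  (∑ v, E.prob H.2 v) / H.order

/-- The indicator function of a local event at the vertex `v` of `G`. -/
def indicator {V : Type} (G : SimpleGraph V) (v : V) : (V → unitInterval) → ℝ :=
  {σ | E.Holds G σ v}.indicator 1

/-- The proportion of the vertices of a labelled finite graph at which a local event holds. -/
def freq (H : FinGraph) (σ : Fin (H.1 + 1) → unitInterval) : ℝ :=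
  (∑ v, E.indicator H.2 v σ) / H.order

theorem prob_nonneg {V : Type} (G : SimpleGraph V) (v : V) : 0 ≤ E.prob G v :=
  measureReal_nonneg

theorem prob_le_one {V : Type} (G : SimpleGraph V) (v : V) : E.prob G v ≤ 1 :=
  measureReal_le_one

theorem prob_embedding {V W : Type} [Countable V] {G : SimpleGraph V} {H : SimpleGraph W}
    (f : G ↪g H) {v : V} (hf : ballSet H (f v) r ⊆ Set.range f) :
    E.prob H (f v) = E.prob G v := by
  rw [prob, prob, ← (measurePreserving_comp_label f f.injective).measureReal_preimage
    (E.measurableSet_holds G v).nullMeasurableSet]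
  congr 1
  ext σ
  exact (E.holds_comp_iff f σ v hf).symm

theorem prob_ballAt {V : Type} (G : SimpleGraph V) (hG : ∀ w, (G.neighborSet w).Finite) (v : V) :
    E.prob (ballAt G hG v r).graph (ballAt G hG v r).root = E.prob G v := by
  have : Countable (ballSet G v r) := (ballSet_finite hG v r).countable
  exact (E.prob_embedding (SimpleGraph.Embedding.induce (ballSet G v r))
    (v := ⟨v, self_mem_ballSet G v r⟩) Subtype.range_coe.ge).symm

theorem prob_rootedIso {X Y : RootedGraph} (h : RootedIso X Y) :
    E.prob X.graph X.root = E.prob Y.graph Y.root := by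
  obtain ⟨e, he⟩ := h
  rw [← he]
  exact (E.prob_embedding e.toEmbedding (e.surjective.range_eq.ge.trans' (Set.subset_univ _))).symm

theorem prob_root_ball (X : RootedGraph) :
    E.prob (X.ball r).graph (X.ball r).root = E.prob X.graph X.root :=
  E.prob_ballAt X.graph X.locallyFinite X.root

theorem continuous_prob_root : Continuous fun X : RootedGraph => E.prob X.graph X.root := by
  refine IsLocallyConstant.continuous ((IsLocallyConstant.iff_eventually_eq _).2 fun X => ?_)
  filter_upwards [Metric.ball_mem_nhds X (ε := (1 / 2) ^ r) (by positivity)] with Y hY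
  rw [← E.prob_root_ball Y, ← E.prob_root_ball X]
  exact E.prob_rootedIso (rootedIso_ball_of_dist_lt hY)

/-- The probability of a local event at the root, as a bounded continuous function on the space of
rooted graphs. -/
def probRootBCF : RootedGraph →ᵇ ℝ :=
  BoundedContinuousFunction.ofNormedAddCommGroup (fun X => E.prob X.graph X.root)
    E.continuous_prob_root 1 fun X => by
      rw [Real.norm_of_nonneg (E.prob_nonneg _ _)]
      exact E.prob_le_one _ _

theorem integrable_prob_root (U : Measure RootedGraph) [IsFiniteMeasure U] :
    Integrable (fun X : RootedGraph => E.prob X.graph X.root) U :=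
  E.probRootBCF.integrable U

theorem tendsto_limitProb (U : Measure RootedGraph) [IsFiniteMeasure U] {s : ℕ → ℕ}
    (E : ∀ n, LocalEvent (s n)) {p : RootedGraph → ℝ}
    (hE : ∀ X, Tendsto (fun n => (E n).prob X.graph X.root) atTop (𝓝 (p X))) :
    Tendsto (fun n => (E n).limitProb U) atTop (𝓝 (∫ X, p X ∂U)) := by
  refine tendsto_integral_of_dominated_convergence (fun _ => (1 : ℝ))
    (fun n => (E n).continuous_prob_root.aestronglyMeasurable) (integrable_const 1)
    (fun n => .of_forall fun X => ?_) (.of_forall hE)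
  rw [Real.norm_of_nonneg ((E n).prob_nonneg _ _)]
  exact (E n).prob_le_one _ _

theorem limitProb_nonneg (U : Measure RootedGraph) : 0 ≤ E.limitProb U :=
  integral_nonneg fun _ => E.prob_nonneg _ _

theorem meanProb_nonneg (H : FinGraph) : 0 ≤ E.meanProb H :=
  div_nonneg (Finset.sum_nonneg fun v _ => E.prob_nonneg H.2 v) (Nat.cast_nonneg _)

end LocalEvent

/-- Convergence in probability to the constant `c` of the random variables `f Aₙ`, where `Aₙ` has
law `P n`. -/
def TendstoInProb {α : Type*} (P : ℕ → PMF α) (f : α → ℝ) (c : ℝ) : Prop :=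
  ∀ ε : ℝ, 0 < ε → Tendsto (fun n => (P n).toOuterMeasure {a | ε < |f a - c|}) atTop (𝓝 0)

theorem ConvergesLocally.tendstoInProb_meanProb {G : ℕ → PMF FinGraph} {U : Measure RootedGraph}
    (hloc : ConvergesLocally G U) {r : ℕ} (E : LocalEvent r) :
    TendstoInProb G E.meanProb (E.limitProb U) := by
  intro ε hε
  have hmean : ∀ H : FinGraph, H.ballMean r E.probRootBCF = E.meanProb H := fun H => by
    rw [FinGraph.ballMean, LocalEvent.meanProb]
    congr 1
    exact Finset.sum_congr rfl fun v _ => E.prob_ballAt H.2 _ v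
  have hlimit : ∫ X, E.probRootBCF (X.ball r) ∂U = E.limitProb U :=
    integral_congr_ae (.of_forall E.prob_root_ball)
  simpa only [hmean, hlimit] using hloc r E.probRootBCF ε hε

end LocalEvents

section LawOfLargeNumbers

open ProbabilityTheory (IndepFun variance covariance)

theorem tendsto_limitProb_largeBallEvent (U : Measure RootedGraph) [IsFiniteMeasure U] (r : ℕ) :
    Tendsto (fun K => (largeBallEvent r K).limitProb U) atTop (𝓝 0) := by
  have hzero : ∀ X : RootedGraph,
      Tendsto (fun K => (largeBallEvent r K).prob X.graph X.root) atTop (𝓝 0) := fun X => by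
    refine tendsto_const_nhds.congr' ?_
    filter_upwards [eventually_ge_atTop (ballSet X.graph X.root r).ncard] with K hK
    simp [LocalEvent.prob, largeBallEvent, hK.not_gt]
  simpa only [integral_zero] using
    LocalEvent.tendsto_limitProb U (fun K => largeBallEvent r K) hzero

theorem ncard_ballSet_le {V : Type} [Fintype V] (G : SimpleGraph V) (v : V) (r K : ℕ) :
    ((ballSet G v r).ncard : ℝ) ≤ K + Fintype.card V * (largeBallEvent r K).prob G v := by
  by_cases hK : K < (ballSet G v r).ncard
  · have hle : (ballSet G v r).ncard ≤ K + Fintype.card V := by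
      rw [← Nat.card_eq_fintype_card]
      exact (Set.ncard_le_card _).trans (Nat.le_add_left _ _)
    simpa [LocalEvent.prob, largeBallEvent, hK] using (Nat.cast_le (α := ℝ)).2 hle
  · simpa [LocalEvent.prob, largeBallEvent, hK] using not_lt.1 hK

theorem mem_ballSet_of_not_disjoint {V : Type*} {G : SimpleGraph V} {r : ℕ} {v w : V}
    (h : ¬ Disjoint (ballSet G v r) (ballSet G w r)) : w ∈ ballSet G v (2 * r) := by
  obtain ⟨x, hx, hx'⟩ := Set.not_disjoint_iff.1 h
  obtain ⟨p, hp⟩ := mem_ballSet_iff.1 hx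
  obtain ⟨q, hq⟩ := mem_ballSet_iff.1 hx'
  refine mem_ballSet_iff.2 ⟨p.append q.reverse, ?_⟩
  rw [SimpleGraph.Walk.length_append, SimpleGraph.Walk.length_reverse]
  omega

namespace LocalEvent

variable {r : ℕ} (E : LocalEvent r)

theorem indicator_nonneg {V : Type} (G : SimpleGraph V) (v : V) (σ : V → unitInterval) :
    0 ≤ E.indicator G v σ :=
  Set.indicator_nonneg (fun _ _ => zero_le_one) σ

theorem indicator_le_one {V : Type} (G : SimpleGraph V) (v : V) (σ : V → unitInterval) :
    E.indicator G v σ ≤ 1 :=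
  Set.indicator_le_self' (fun _ _ => zero_le_one) σ

theorem measurable_indicator {V : Type} [Countable V] (G : SimpleGraph V) (v : V) :
    Measurable (E.indicator G v) :=
  measurable_one.indicator (E.measurableSet_holds G v)

theorem memLp_indicator {V : Type} [Countable V] (G : SimpleGraph V) (v : V) (p : ℝ≥0∞) :
    MemLp (E.indicator G v) p (labelLaw V) :=
  MemLp.of_bound (E.measurable_indicator G v).aestronglyMeasurable 1 <| .of_forall fun σ => by
    rw [Real.norm_of_nonneg (E.indicator_nonneg G v σ)]
    exact E.indicator_le_one G v σ

theorem integral_indicator {V : Type} [Countable V] (G : SimpleGraph V) (v : V) :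
    ∫ σ, E.indicator G v σ ∂(labelLaw V) = E.prob G v :=
  integral_indicator_one (E.measurableSet_holds G v)

theorem indepFun_indicator {V : Type} [Finite V] (G : SimpleGraph V) {v w : V}
    (hvw : Disjoint (ballSet G v r) (ballSet G w r)) :
    IndepFun (E.indicator G v) (E.indicator G w) (labelLaw V) := by
  classical
  have hfactor : ∀ u : V, ∃ φ : ((ballSet G u r).toFinite.toFinset → unitInterval) → ℝ,
      Measurable φ ∧ E.indicator G u = φ ∘ fun σ i => σ i := fun u => by
    have hu : u ∈ (ballSet G u r).toFinite.toFinset := by simpa using self_mem_ballSet G u r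
    refine ⟨E.indicator (G.induce _) ⟨u, hu⟩, E.measurable_indicator _ _, funext fun σ => ?_⟩
    have hiff := E.holds_comp_iff (SimpleGraph.Embedding.induce _) σ ⟨u, hu⟩ fun x hx =>
      ⟨⟨x, by simpa using hx⟩, rfl⟩
    exact if_congr hiff.symm rfl rfl
  obtain ⟨φ, hφ, hv⟩ := hfactor v
  obtain ⟨ψ, hψ, hw⟩ := hfactor w
  rw [hv, hw]
  exact ((iIndepFun_label V).indepFun_finset _ _ (by simpa using hvw)
    fun i => measurable_pi_apply i).comp hφ hψ

open Classical in
theorem covariance_indicator_le {V : Type} [Finite V] (G : SimpleGraph V) (v w : V) :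
    covariance (E.indicator G v) (E.indicator G w) (labelLaw V) ≤
      if w ∈ ballSet G v (2 * r) then 1 else 0 := by
  have hL2 : ∀ u, MemLp (E.indicator G u) 2 (labelLaw V) := fun u => E.memLp_indicator G u 2
  by_cases hvw : Disjoint (ballSet G v r) (ballSet G w r)
  · rw [(E.indepFun_indicator G hvw).covariance_eq_zero (hL2 v) (hL2 w)]
    split_ifs <;> norm_num
  · rw [if_pos (mem_ballSet_of_not_disjoint hvw), ProbabilityTheory.covariance_eq_sub (hL2 v)
      (hL2 w), E.integral_indicator, E.integral_indicator]
    have hle : ∫ σ, (E.indicator G v * E.indicator G w) σ ∂(labelLaw V) ≤ 1 := by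
      refine (integral_mono ((hL2 v).integrable_mul (hL2 w)) (integrable_const 1)
        fun σ => ?_).trans_eq (by simp)
      exact mul_le_one₀ (E.indicator_le_one G v σ) (E.indicator_nonneg G w σ)
        (E.indicator_le_one G w σ)
    linarith [mul_nonneg (E.prob_nonneg G v) (E.prob_nonneg G w)]

theorem variance_sum_indicator_le {V : Type} [Fintype V] (G : SimpleGraph V) (K : ℕ) :
    variance (fun σ => ∑ v, E.indicator G v σ) (labelLaw V) ≤
      Fintype.card V * (K + ∑ v, (largeBallEvent (2 * r) K).prob G v) := by
  classical
  rw [ProbabilityTheory.variance_fun_sum' fun v _ => E.memLp_indicator G v 2]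
  calc ∑ v, ∑ w, covariance (E.indicator G v) (E.indicator G w) (labelLaw V)
      ≤ ∑ v, ∑ w, if w ∈ ballSet G v (2 * r) then 1 else 0 :=
        Finset.sum_le_sum fun v _ => Finset.sum_le_sum fun w _ => E.covariance_indicator_le G v w
    _ = ∑ v, ((ballSet G v (2 * r)).ncard : ℝ) := by
        simp only [Finset.sum_boole, Set.ncard_eq_toFinset_card', Set.filter_mem_univ_eq_toFinset]
    _ ≤ ∑ v, (K + Fintype.card V * (largeBallEvent (2 * r) K).prob G v) :=
        Finset.sum_le_sum fun v _ => ncard_ballSet_le G v (2 * r) K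
    _ = Fintype.card V * (K + ∑ v, (largeBallEvent (2 * r) K).prob G v) := by
        rw [Finset.sum_add_distrib, Finset.sum_const, Finset.card_univ, nsmul_eq_mul,
          ← Finset.mul_sum, mul_add]

theorem integral_freq (H : FinGraph) : ∫ σ, E.freq H σ ∂(labelLaw _) = E.meanProb H := by
  simp only [freq, meanProb, integral_div, ← E.integral_indicator H.2]
  rw [integral_finsetSum _ fun v _ => (E.memLp_indicator H.2 v 1).integrable le_rfl]

theorem freq_eq_inv_mul (H : FinGraph) :
    E.freq H = fun σ => (H.order : ℝ)⁻¹ * ∑ v, E.indicator H.2 v σ :=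
  funext fun _ => div_eq_inv_mul _ _

theorem variance_freq_le (H : FinGraph) (K : ℕ) :
    variance (E.freq H) (labelLaw _) ≤
      K / H.order + (largeBallEvent (2 * r) K).meanProb H := by
  have horder := H.order_cast_pos
  have hcard : Fintype.card (Fin (H.1 + 1)) = H.order := Fintype.card_fin _
  calc variance (E.freq H) (labelLaw _)
      = (H.order : ℝ)⁻¹ ^ 2 * variance (fun σ => ∑ v, E.indicator H.2 v σ) (labelLaw _) := by
        rw [E.freq_eq_inv_mul, ProbabilityTheory.variance_const_mul]
    _ ≤ (H.order : ℝ)⁻¹ ^ 2 *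
        (H.order * (K + ∑ v, (largeBallEvent (2 * r) K).prob H.2 v)) := by
        gcongr
        exact hcard ▸ E.variance_sum_indicator_le H.2 K
    _ = K / H.order + (largeBallEvent (2 * r) K).meanProb H := by
        rw [meanProb]; field_simp

theorem labelLaw_freq_deviation_le (H : FinGraph) (K : ℕ) {δ : ℝ} (hδ : 0 < δ) :
    (labelLaw _).real {σ | δ ≤ |E.freq H σ - E.meanProb H|} ≤
      (K / H.order + (largeBallEvent (2 * r) K).meanProb H) / δ ^ 2 := by
  have hL2 : MemLp (E.freq H) 2 (labelLaw _) := by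
    rw [E.freq_eq_inv_mul]
    exact (memLp_finsetSum _ fun v _ => E.memLp_indicator H.2 v 2).const_mul _
  have hcheb := ProbabilityTheory.meas_ge_le_variance_div_sq hL2 hδ
  rw [E.integral_freq] at hcheb
  have hnonneg := (largeBallEvent (2 * r) K).meanProb_nonneg H
  refine ENNReal.toReal_le_of_le_ofReal (by positivity) (hcheb.trans ?_)
  gcongr
  exact E.variance_freq_le H K

theorem labelLaw_freq_deviation_le_of_meanProb (H : FinGraph) (K : ℕ) {c ε : ℝ} (hε : 0 < ε)
    (hmean : |E.meanProb H - c| ≤ ε / 2) :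
    (labelLaw _).real {σ | ε < |E.freq H σ - c|} ≤
      (K / H.order + (largeBallEvent (2 * r) K).meanProb H) / (ε / 2) ^ 2 := by
  refine (measureReal_mono fun σ (hσ : ε < _) => ?_).trans
    (E.labelLaw_freq_deviation_le H K (half_pos hε))
  have htriangle := abs_sub_le (E.freq H σ) (E.meanProb H) c
  exact le_of_add_le_add_right (a := ε / 2) (by linarith)

theorem tendstoInProb_freq_deviation {G : ℕ → PMF FinGraph} {U : Measure RootedGraph}
    [IsFiniteMeasure U] (hord : OrderTendsto G) (hloc : ConvergesLocally G U) {ε : ℝ}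
    (hε : 0 < ε) :
    TendstoInProb G (fun H => (labelLaw _).real {σ | ε < |E.freq H σ - E.limitProb U|}) 0 := by
  intro η hη
  have hκ : 0 < η * (ε / 2) ^ 2 / 3 := by positivity
  set κ := η * (ε / 2) ^ 2 / 3 with hκ_def
  obtain ⟨K, hK⟩ :=
    ((tendsto_limitProb_largeBallEvent U (2 * r)).eventually (gt_mem_nhds hκ)).exists
  obtain ⟨N, hN⟩ := exists_nat_ge (K / κ)
  set L := largeBallEvent (2 * r) K
  have hbad : Tendsto (fun n => (G n).toOuterMeasure {H | H.order ≤ N} +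
      ((G n).toOuterMeasure {H | ε / 2 < |E.meanProb H - E.limitProb U|} +
        (G n).toOuterMeasure {H | κ < |L.meanProb H - L.limitProb U|})) atTop (𝓝 0) := by
    simpa only [add_zero] using (hord N).add
      ((hloc.tendstoInProb_meanProb E _ (half_pos hε)).add (hloc.tendstoInProb_meanProb L _ hκ))
  refine tendsto_of_tendsto_of_tendsto_of_le_of_le tendsto_const_nhds hbad (fun _ => zero_le)
    fun n => ?_
  refine (measure_mono fun H hH => ?_).trans
    ((measure_union_le _ _).trans (add_le_add_right (measure_union_le _ _) _))
  by_contra hgood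
  simp only [Set.mem_union, Set.mem_ofPred_eq, not_or, not_le, not_lt] at hgood
  obtain ⟨horder, hmean, hlarge⟩ := hgood
  refine (show η < _ from hH).not_ge ?_
  rw [sub_zero, abs_of_nonneg measureReal_nonneg]
  have hKN : K / H.order ≤ κ :=
    (div_le_comm₀ hκ H.order_cast_pos).1 (hN.trans (by exact_mod_cast horder.le))
  refine (E.labelLaw_freq_deviation_le_of_meanProb H K hε hmean).trans ?_
  rw [div_le_iff₀ (by positivity)]
  linarith [le_abs_self (L.meanProb H - L.limitProb U)]

end LocalEvent

end LawOfLargeNumbers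

section ConvergenceInProbability

variable {α : Type*} {f : α → ℝ} {c : ℝ}

theorem toOuterMeasure_add_compl (p : PMF α) (s : Set α) :
    p.toOuterMeasure s + p.toOuterMeasure sᶜ = 1 := by
  rw [PMF.toOuterMeasure_apply, PMF.toOuterMeasure_apply, ← ENNReal.tsum_add, ← p.tsum_coe]
  exact tsum_congr fun a => congrFun (Set.indicator_self_add_compl s p) a

theorem mul_toOuterMeasure_le_tsum (p : PMF α) (g : α → ℝ≥0∞) (b : ℝ≥0∞) :
    b * p.toOuterMeasure {a | b ≤ g a} ≤ ∑' a, p a * g a := by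
  rw [PMF.toOuterMeasure_apply, ← ENNReal.tsum_mul_left]
  refine ENNReal.tsum_le_tsum fun a => ?_
  by_cases ha : b ≤ g a
  · rw [Set.indicator_of_mem (s := {a | b ≤ g a}) ha, mul_comm]
    gcongr
  · simp [Set.indicator_of_notMem (s := {a | b ≤ g a}) ha]

theorem tsum_mul_le_add_toOuterMeasure (p : PMF α) {g : α → ℝ≥0∞} (hg : ∀ a, g a ≤ 1)
    (b : ℝ≥0∞) : ∑' a, p a * g a ≤ b + p.toOuterMeasure {a | b < g a} := by
  have hpoint : ∀ a, p a * g a ≤ p a * b + {a | b < g a}.indicator p a := fun a => by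
    by_cases ha : b < g a
    · rw [Set.indicator_of_mem (s := {a | b < g a}) ha]
      exact (mul_le_of_le_one_right' (hg a)).trans le_add_self
    · exact (mul_le_mul_right (not_lt.1 ha) _).trans le_self_add
  refine (ENNReal.tsum_le_tsum hpoint).trans_eq ?_
  rw [ENNReal.tsum_add, ENNReal.tsum_mul_right, p.tsum_coe, one_mul, PMF.toOuterMeasure_apply]

namespace TendstoInProb

variable {P : ℕ → PMF α}

theorem tendsto_one (h : TendstoInProb P f c) {ε : ℝ} (hε : 0 < ε) :
    Tendsto (fun n => (P n).toOuterMeasure {a | |f a - c| ≤ ε}) atTop (𝓝 1) := by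
  have hsub : Tendsto (fun n => 1 - (P n).toOuterMeasure {a | ε < |f a - c|}) atTop (𝓝 1) := by
    simpa only [tsub_zero] using
      ENNReal.Tendsto.sub (tendsto_const_nhds (x := 1)) (h ε hε) (.inl ENNReal.one_ne_top)
  refine hsub.congr fun n => (ENNReal.eq_sub_of_add_eq' ENNReal.one_ne_top ?_).symm
  simpa only [Set.compl_ofPred, not_le] using
    toOuterMeasure_add_compl (P n) {a | |f a - c| ≤ ε}

theorem tendsto_tsum_mul (h : TendstoInProb P f 0) (hf : ∀ a, f a ≤ 1) :
    Tendsto (fun n => ∑' a, P n a * ENNReal.ofReal (f a)) atTop (𝓝 0) := by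
  refine ENNReal.tendsto_nhds_zero.2 fun η hη => ?_
  obtain ⟨ε, -, hε, hεη⟩ := ENNReal.lt_iff_exists_real_btwn.1 hη
  rw [ENNReal.ofReal_pos] at hε
  have hbound : Tendsto (fun n => ENNReal.ofReal ε + (P n).toOuterMeasure {a | ε < |f a - 0|})
      atTop (𝓝 (ENNReal.ofReal ε)) := by
    simpa only [add_zero] using (h ε hε).const_add (ENNReal.ofReal ε)
  filter_upwards [hbound.eventually (gt_mem_nhds hεη)] with n hn
  refine (tsum_mul_le_add_toOuterMeasure (P n) (fun a => ENNReal.ofReal_le_one.2 (hf a))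
    (ENNReal.ofReal ε)).trans (le_trans ?_ hn.le)
  gcongr with a
  intro ha
  rw [sub_zero]
  exact ((ENNReal.ofReal_lt_ofReal_iff_of_nonneg hε.le).1 ha).trans_le (le_abs_self _)

theorem ofReal_le_liminf (h : TendstoInProb P f c) :
    ENNReal.ofReal c ≤ liminf (fun n => ∑' a, P n a * ENNReal.ofReal (f a)) atTop := by
  have hlower : ∀ ε : ℝ, 0 < ε → ENNReal.ofReal (c - ε) ≤
      liminf (fun n => ∑' a, P n a * ENNReal.ofReal (f a)) atTop := fun ε hε => by
    have hlim := ENNReal.Tendsto.const_mul (a := ENNReal.ofReal (c - ε)) (h.tendsto_one hε)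
      (.inl one_ne_zero)
    rw [mul_one] at hlim
    rw [← hlim.liminf_eq]
    refine liminf_le_liminf (.of_forall fun n => ?_)
    refine le_trans ?_ (mul_toOuterMeasure_le_tsum (P n) _ (ENNReal.ofReal (c - ε)))
    gcongr with a
    intro ha
    exact ENNReal.ofReal_le_ofReal (by linarith [abs_le.1 ha])
  have hcont : Tendsto (fun ε => ENNReal.ofReal (c - ε)) (𝓝 0) (𝓝 (ENNReal.ofReal (c - 0))) :=
    ENNReal.tendsto_ofReal (tendsto_const_nhds.sub tendsto_id)
  rw [sub_zero] at hcont
  exact le_of_tendsto (hcont.mono_left (nhdsWithin_le_nhds (s := Set.Ioi 0)))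
    (eventually_mem_nhdsWithin.mono hlower)

end TendstoInProb

end ConvergenceInProbability

section GreedySet

variable {V : Type*} {G : SimpleGraph V} {l : List V} {v : V}

theorem mem_greedySet_append_singleton {x : V} :
    v ∈ greedySet G (l ++ [x]) ↔
      v ∈ greedySet G l ∨ v = x ∧ ∀ w ∈ greedySet G l, ¬ G.Adj x w := by
  classical
  have hstep : greedySet G (l ++ [x]) = if ∀ w ∈ greedySet G l, ¬ G.Adj x w then
      insert x (greedySet G l) else greedySet G l := by
    simp only [greedySet, List.foldl_append, List.foldl_cons, List.foldl_nil]
    congr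
  rw [hstep]
  split_ifs with h
  · rw [Finset.mem_insert, or_comm, and_iff_left h]
  · exact (or_iff_left fun hv => h hv.2).symm

theorem mem_of_mem_greedySet (hv : v ∈ greedySet G l) : v ∈ l := by
  induction l using List.reverseRecOn with
  | nil => simp [greedySet] at hv
  | append_singleton l x ih =>
    rw [List.mem_append, List.mem_singleton]
    exact (mem_greedySet_append_singleton.1 hv).imp ih And.left

theorem mem_greedySet_append_of_notMem {l' : List V} (hv : v ∉ l') :
    v ∈ greedySet G (l ++ l') ↔ v ∈ greedySet G l := by
  induction l' using List.reverseRecOn with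
  | nil => rw [List.append_nil]
  | append_singleton l' x ih =>
    rw [List.mem_append, List.mem_singleton, not_or] at hv
    rw [← List.append_assoc, mem_greedySet_append_singleton, ih hv.1]
    exact or_iff_left fun h => hv.2 h.1

theorem mem_greedySet_append_cons {l' : List V} (hl : v ∉ l) (hl' : v ∉ l') :
    v ∈ greedySet G (l ++ v :: l') ↔ ∀ w ∈ greedySet G l, ¬ G.Adj v w := by
  rw [List.append_cons, mem_greedySet_append_of_notMem hl', mem_greedySet_append_singleton,
    or_iff_right (mt mem_of_mem_greedySet hl), and_iff_right rfl]

theorem mem_greedySet_iff {α : Type*} [Preorder α] {σ : V → α} (hall : ∀ w, w ∈ l)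
    (hl : l.Pairwise fun a b => σ a < σ b) :
    v ∈ greedySet G l ↔ ∀ w, G.Adj v w → σ w < σ v → w ∉ greedySet G l := by
  obtain ⟨s, t, rfl⟩ := List.append_of_mem (hall v)
  obtain ⟨-, ht, hst⟩ := List.pairwise_append.1 hl
  have hbefore : ∀ w ∈ s, σ w < σ v := fun w hw => hst w hw v List.mem_cons_self
  have hafter : ∀ w ∈ v :: t, ¬ σ w < σ v := fun w hw => by
    rcases List.mem_cons.1 hw with rfl | hw
    · exact lt_irrefl _
    · exact ((List.pairwise_cons.1 ht).1 w hw).not_gt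
  have hvs : v ∉ s := fun h => lt_irrefl _ (hbefore v h)
  have hvt : v ∉ t := fun h => lt_irrefl _ ((List.pairwise_cons.1 ht).1 v h)
  rw [mem_greedySet_append_cons hvs hvt]
  constructor
  · intro h w hvw hσ hw
    exact h w ((mem_greedySet_append_of_notMem fun hwt => hafter w hwt hσ).1 hw) hvw
  · intro h w hw hvw
    have hσ := hbefore w (mem_of_mem_greedySet hw)
    exact h w hvw hσ ((mem_greedySet_append_of_notMem fun hwt => hafter w hwt hσ).2 hw)

theorem mem_greedySet_iff_occupied {σ : V → unitInterval} {k : ℕ} (hall : ∀ w, w ∈ l)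
    (hl : l.Pairwise fun a b => σ a < σ b) (h : ¬ HasDecreasingPath G σ k v) :
    v ∈ greedySet G l ↔ Occupied G σ k v := by
  induction k generalizing v with
  | zero => exact absurd trivial h
  | succ k ih =>
    rw [mem_greedySet_iff hall hl]
    exact forall_congr' fun w => forall₂_congr fun hvw hσ =>
      not_congr (ih fun hw => h ⟨w, hvw, hσ, hw⟩)

theorem abs_greedyRatio_sub_freq_le (H : FinGraph) (r : ℕ) {π : Equiv.Perm (Fin (H.1 + 1))}
    {σ : Fin (H.1 + 1) → unitInterval} (hσ : StrictMono (σ ∘ π)) :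
    |greedyRatio H π - (occupiedEvent r).freq H σ| ≤ (decreasingPathEvent r).freq H σ := by
  classical
  have hall : ∀ v, v ∈ List.ofFn π := fun v => List.mem_ofFn.2 (π.surjective v)
  have hl : (List.ofFn π).Pairwise fun a b => σ a < σ b :=
    List.pairwise_ofFn.2 fun i j hij => hσ hij
  have hcard : ((greedySet H.2 (List.ofFn π)).card : ℝ) =
      ∑ v, if v ∈ greedySet H.2 (List.ofFn π) then (1 : ℝ) else 0 := by
    simp
  rw [greedyRatio, LocalEvent.freq, LocalEvent.freq, ← sub_div, abs_div, Nat.abs_cast, hcard,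
    ← Finset.sum_sub_distrib]
  refine div_le_div_of_nonneg_right ((Finset.abs_sum_le_sum_abs _ _).trans
    (Finset.sum_le_sum fun v _ => ?_)) (Nat.cast_nonneg _)
  simp only [LocalEvent.indicator, occupiedEvent, decreasingPathEvent, Set.indicator_apply,
    Set.mem_ofPred_eq, Pi.one_apply]
  by_cases h : HasDecreasingPath H.2 σ r v
  · rw [if_pos h]
    split_ifs <;> simp
  · rw [if_neg h, if_congr (mem_greedySet_iff_occupied hall hl h) rfl rfl, sub_self, abs_zero]

end GreedySet

section NonexplosiveGrowth

variable {V : Type*} {G : SimpleGraph V} {σ : V → unitInterval} {v w : V} {k : ℕ}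

theorem past_subset_ballSet (h : ¬ HasDecreasingPath G σ k v) : past G σ v ⊆ ballSet G v k := by
  induction k generalizing v with
  | zero => exact absurd trivial h
  | succ k ih =>
    intro x hx
    rcases Relation.ReflTransGen.cases_head hx with rfl | ⟨w, ⟨hvw, hσ⟩, hwx⟩
    · exact self_mem_ballSet _ _ _
    · exact ballSet_subset_of_adj hvw k (ih (fun hw => h ⟨w, hvw, hσ, hw⟩) hwx)

theorem label_le_of_mem_past (hw : w ∈ past G σ v) : σ w ≤ σ v := by
  induction hw with
  | refl => exact le_rfl
  | tail _ h ih => exact h.2.le.trans ih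

theorem HasDecreasingPath.lt_encard_past (h : HasDecreasingPath G σ k v) :
    k < (past G σ v).encard := by
  induction k generalizing v with
  | zero => exact Set.encard_pos.2 ⟨v, .refl⟩
  | succ k ih =>
    obtain ⟨w, hvw, hσ, hw⟩ := h
    have hv : v ∉ past G σ w := fun hv => (label_le_of_mem_past hv).not_gt hσ
    calc ((k + 1 : ℕ) : ℕ∞) < (past G σ w).encard + 1 := by
          rw [Nat.cast_add_one, ENat.add_lt_add_iff_right ENat.one_ne_top]
          exact ih hw
      _ = (insert v (past G σ w)).encard := (Set.encard_insert_of_notMem hv).symm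
      _ ≤ (past G σ v).encard :=
          Set.encard_mono (Set.insert_subset .refl (past_subset_of_adj hvw hσ))

theorem finite_past_iff (hG : ∀ w, (G.neighborSet w).Finite) :
    (past G σ v).Finite ↔ ∃ k, ¬ HasDecreasingPath G σ k v := by
  constructor
  · intro h
    refine ⟨(past G σ v).ncard, fun hpath => ?_⟩
    exact hpath.lt_encard_past.ne h.cast_ncard_eq
  · rintro ⟨k, hk⟩
    exact (ballSet_finite hG v k).subset (past_subset_ballSet hk)

/-- The probability that the past of the root is infinite. -/
def infinitePastProb (X : RootedGraph) : ℝ :=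
  (labelLaw X.V).real {σ | ¬ (past X.graph σ X.root).Finite}

theorem tendsto_prob_decreasingPathEvent (X : RootedGraph) :
    Tendsto (fun r => (decreasingPathEvent r).prob X.graph X.root) atTop
      (𝓝 (infinitePastProb X)) := by
  have hinter : {σ : X.V → unitInterval | ¬ (past X.graph σ X.root).Finite} =
      ⋂ r, {σ | HasDecreasingPath X.graph σ r X.root} := by
    ext σ
    simp only [finite_past_iff X.locallyFinite, not_exists, not_not, Set.mem_iInter,
      Set.mem_ofPred_eq]
  rw [infinitePastProb, hinter]
  exact (ENNReal.tendsto_toReal (measure_ne_top _ _)).comp (tendsto_measure_iInter_atTop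
    (fun r => (measurableSet_hasDecreasingPath X.graph r X.root).nullMeasurableSet)
    (antitone_nat_of_succ_le fun r σ hσ => HasDecreasingPath.of_succ hσ)
    ⟨0, measure_ne_top _ _⟩)

theorem integrable_infinitePastProb (U : Measure RootedGraph) [IsFiniteMeasure U] :
    Integrable infinitePastProb U := by
  have hmeas : Measurable infinitePastProb := measurable_of_tendsto_metrizable
    (fun r => (decreasingPathEvent r).continuous_prob_root.measurable)
    (tendsto_pi_nhds.2 tendsto_prob_decreasingPathEvent)
  refine .of_bound hmeas.aestronglyMeasurable 1 (.of_forall fun X => ?_)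
  rw [infinitePastProb, Real.norm_of_nonneg measureReal_nonneg]
  exact measureReal_le_one

theorem tendsto_limitProb_decreasingPathEvent (U : Measure RootedGraph) [IsFiniteMeasure U] :
    Tendsto (fun r => (decreasingPathEvent r).limitProb U) atTop
      (𝓝 (∫ X, infinitePastProb X ∂U)) :=
  LocalEvent.tendsto_limitProb U decreasingPathEvent tendsto_prob_decreasingPathEvent

theorem nonexplosiveGrowth_iff_infinitePastProb {U : Measure RootedGraph} :
    NonexplosiveGrowth U ↔ ∀ᵐ X ∂U, infinitePastProb X = 0 :=
  eventually_congr (.of_forall fun X => by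
    rw [ae_iff, infinitePastProb, measureReal_eq_zero_iff])

theorem nonexplosiveGrowth_iff_tendsto {U : Measure RootedGraph} [IsFiniteMeasure U] :
    NonexplosiveGrowth U ↔
      Tendsto (fun r => (decreasingPathEvent r).limitProb U) atTop (𝓝 0) := by
  have hlim := tendsto_limitProb_decreasingPathEvent U
  have hzero : ∫ X, infinitePastProb X ∂U = 0 ↔ ∀ᵐ X ∂U, infinitePastProb X = 0 :=
    integral_eq_zero_iff_of_nonneg (fun _ => measureReal_nonneg) (integrable_infinitePastProb U)
  rw [nonexplosiveGrowth_iff_infinitePastProb, ← hzero]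
  exact ⟨fun h => h ▸ hlim, tendsto_nhds_unique hlim⟩

end NonexplosiveGrowth

section PathCounting

variable {V : Type*} {G : SimpleGraph V}

theorem HasDecreasingPath.exists_walk {σ : V → unitInterval} {k : ℕ} {v : V}
    (h : HasDecreasingPath G σ k v) :
    ∃ w, ∃ p : G.Walk v w, p.length = k ∧ p.support.Pairwise fun a b => σ b < σ a := by
  induction k generalizing v with
  | zero => exact ⟨v, .nil, rfl, List.pairwise_singleton _ _⟩
  | succ k ih =>
    obtain ⟨w, hvw, hσ, hw⟩ := h
    obtain ⟨x, p, hlen, hdec⟩ := ih hw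
    refine ⟨x, .cons hvw p, congrArg _ hlen, List.pairwise_cons.2 ⟨fun u hu => ?_, hdec⟩⟩
    rw [← p.cons_tail_support, List.pairwise_cons] at hdec
    rcases p.mem_support_iff.1 hu with rfl | hu
    · exact hσ
    · exact (hdec.1 u hu).trans hσ

theorem labelLaw_walk_decreasing_le {v w : V} (p : G.Walk v w) (hp : p.IsPath) :
    labelLaw V {σ | p.support.Pairwise fun a b => σ b < σ a} ≤ (p.length.factorial : ℝ≥0∞)⁻¹ := by
  rw [labelLaw_pairwise_gt hp.support_nodup, p.length_support]
  gcongr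
  exact Nat.le_succ _

theorem labelLaw_hasDecreasingPath_le (G : SimpleGraph V) (r : ℕ) (v : V) :
    labelLaw V {σ | HasDecreasingPath G σ r v} ≤ (pathCount G v r : ℝ≥0∞) / r.factorial := by
  rcases eq_or_ne (pathCount G v r) ⊤ with htop | hfin
  · simp [htop, ENNReal.top_div]
  let S : Set (Σ w, G.Walk v w) := {p | p.2.IsPath ∧ p.2.length ≤ r}
  have : Countable S := (Set.encard_ne_top_iff.1 hfin).countable.to_subtype
  calc labelLaw V {σ | HasDecreasingPath G σ r v}
      ≤ labelLaw V (⋃ p : S, {σ | p.1.2.length = r ∧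
          p.1.2.support.Pairwise fun a b => σ b < σ a}) := by
        refine measure_mono fun σ hσ => ?_
        obtain ⟨w, p, hlen, hdec⟩ := HasDecreasingPath.exists_walk hσ
        have hp : p.IsPath :=
          (SimpleGraph.Walk.isPath_def p).2 (hdec.imp fun h => ne_of_apply_ne σ h.ne')
        exact Set.mem_iUnion.2 ⟨⟨⟨w, p⟩, hp, hlen.le⟩, hlen, hdec⟩
    _ ≤ ∑' p : S, labelLaw V {σ | p.1.2.length = r ∧
          p.1.2.support.Pairwise fun a b => σ b < σ a} := measure_iUnion_le _
    _ ≤ ∑' _ : S, (r.factorial : ℝ≥0∞)⁻¹ := by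
        refine ENNReal.tsum_le_tsum fun ⟨p, hp, _⟩ => ?_
        by_cases hlen : p.2.length = r
        · exact (measure_mono fun σ hσ => hσ.2).trans (hlen ▸ labelLaw_walk_decreasing_le p.2 hp)
        · simp [hlen]
    _ = (pathCount G v r : ℝ≥0∞) / r.factorial := by
        rw [ENNReal.tsum_set_const, div_eq_mul_inv]
        rfl

theorem labelLaw_hasDecreasingPath_le_min (G : SimpleGraph V) (r : ℕ) (v : V) :
    labelLaw V {σ | HasDecreasingPath G σ r v} ≤
      ((min (pathCount G v r) r.factorial : ℕ∞) : ℝ≥0∞) / r.factorial := by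
  rcases min_choice (pathCount G v r) r.factorial with h | h <;> rw [h]
  · exact labelLaw_hasDecreasingPath_le G r v
  · rw [ENat.toENNReal_coe, ENNReal.div_self (by positivity) (ENNReal.natCast_ne_top _)]
    exact prob_le_one

theorem tsum_meanProb_decreasingPathEvent_le (P : PMF FinGraph) (r : ℕ) :
    ∑' H, P H * ENNReal.ofReal ((decreasingPathEvent r).meanProb H) ≤
      truncPathMean P r r.factorial / r.factorial := by
  rw [truncPathMean, div_eq_mul_inv, ← ENNReal.tsum_mul_right]
  refine ENNReal.tsum_le_tsum fun H => ?_
  rw [mul_assoc, LocalEvent.meanProb, ENNReal.ofReal_div_of_pos H.order_cast_pos,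
    ENNReal.ofReal_natCast, ENNReal.ofReal_sum_of_nonneg fun v _ => LocalEvent.prob_nonneg _ _ _,
    ← ENNReal.mul_div_right_comm, Finset.sum_mul]
  gcongr with v
  rw [LocalEvent.prob, ofReal_measureReal, ← div_eq_mul_inv]
  exact labelLaw_hasDecreasingPath_le_min H.2 r v

/-- A vertex sees at most `N(r)` paths of length `r`, each of which decreases with probability
`1 / (r + 1)!`; truncating at `M = r!` costs nothing, a probability being at most `1`. -/
theorem limitProb_decreasingPathEvent_le {G : ℕ → PMF FinGraph} {U : Measure RootedGraph}
    (hloc : ConvergesLocally G U) (r : ℕ) :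
    ENNReal.ofReal ((decreasingPathEvent r).limitProb U) ≤ muStar G r / r.factorial := by
  have hfact : (r.factorial : ℝ≥0∞) ≠ 0 := by positivity
  calc ENNReal.ofReal ((decreasingPathEvent r).limitProb U)
      ≤ liminf (fun n => ∑' H, G n H * ENNReal.ofReal ((decreasingPathEvent r).meanProb H))
          atTop := (hloc.tendstoInProb_meanProb (decreasingPathEvent r)).ofReal_le_liminf
    _ ≤ limsup (fun n => truncPathMean (G n) r r.factorial / r.factorial) atTop :=
        (liminf_le_liminf (.of_forall fun n => tsum_meanProb_decreasingPathEvent_le (G n) r)).trans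
          liminf_le_limsup
    _ = limsup (fun n => truncPathMean (G n) r r.factorial) atTop / r.factorial := by
        simp only [div_eq_mul_inv]
        rw [ENNReal.limsup_mul_const_of_ne_top (ENNReal.inv_ne_top.2 hfact), mul_comm]
    _ ≤ muStar G r / r.factorial := by
        gcongr
        exact le_iSup (fun M : ℕ => limsup (fun n => truncPathMean (G n) r M) atTop) r.factorial

theorem SubfactorialPathGrowth.nonexplosiveGrowth {G : ℕ → PMF FinGraph}
    {U : Measure RootedGraph} [IsFiniteMeasure U] (hG : SubfactorialPathGrowth G)
    (hloc : ConvergesLocally G U) : NonexplosiveGrowth U := by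
  have hlim : Tendsto (fun r => ENNReal.ofReal ((decreasingPathEvent r).limitProb U)) atTop
      (𝓝 0) := tendsto_of_tendsto_of_tendsto_of_le_of_le tendsto_const_nhds hG
    (fun _ => zero_le) (limitProb_decreasingPathEvent_le hloc)
  refine nonexplosiveGrowth_iff_tendsto.2 ?_
  simpa only [ENNReal.toReal_ofReal (LocalEvent.limitProb_nonneg _ U), ENNReal.toReal_zero,
    Function.comp_def]
    using (ENNReal.tendsto_toReal ENNReal.zero_ne_top).comp hlim

end PathCounting

section RootDensity

theorem rootOccupied_iff {X : RootedGraph} {σ : X.V → unitInterval} {k : ℕ}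
    (hσ : Function.Injective σ) (h : ¬ HasDecreasingPath X.graph σ k X.root) :
    RootOccupied X σ ↔ Occupied X.graph σ k X.root := by
  let f : X.graph.induce (past X.graph σ X.root) ↪g X.graph := SimpleGraph.Embedding.induce _
  have hf : ballSet X.graph X.root k ∩ past X.graph σ X.root ⊆ Set.range f := fun x hx =>
    ⟨⟨x, hx.2⟩, rfl⟩
  have hroot : X.root ∈ past X.graph σ X.root := .refl
  have hgreedy : ∀ l : List (past X.graph σ X.root), (∀ v, v ∈ l) →
      l.Pairwise (fun a b => σ a.1 < σ b.1) →
      (⟨X.root, hroot⟩ ∈ greedySet (X.graph.induce (past X.graph σ X.root)) l ↔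
        Occupied X.graph σ k X.root) := fun l hall hl => by
    rw [mem_greedySet_iff_occupied (σ := σ ∘ f) hall hl
      (mt (hasDecreasingPath_comp_iff (v := ⟨X.root, hroot⟩) f hf).1 h)]
    exact occupied_comp_iff (v := ⟨X.root, hroot⟩) f hf
  constructor
  · rintro ⟨l, hall, hl, hmem⟩
    exact (hgreedy l hall hl).1 hmem
  · intro hocc
    have : Fintype (past X.graph σ X.root) :=
      ((finite_past_iff X.locallyFinite).2 ⟨k, h⟩).fintype
    let : LinearOrder (past X.graph σ X.root) :=
      LinearOrder.lift' (fun v => σ v.1) (hσ.comp Subtype.val_injective)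
    have hall : ∀ v, v ∈ (Finset.univ : Finset (past X.graph σ X.root)).sort (· ≤ ·) :=
      fun v => (Finset.mem_sort _).2 (Finset.mem_univ v)
    have hl := (Finset.sortedLT_sort (Finset.univ : Finset (past X.graph σ X.root))).pairwise
    exact ⟨_, hall, hl, (hgreedy _ hall hl).2 hocc⟩

theorem rootOccupied_of_lt {X : RootedGraph} {σ : X.V → unitInterval}
    (hσ : Function.Injective σ) (h : ∀ w, X.graph.Adj X.root w → σ X.root < σ w) :
    RootOccupied X σ :=
  (rootOccupied_iff (k := 1) hσ fun ⟨w, hw, hlt, _⟩ => hlt.not_gt (h w hw)).2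
    fun w hw hlt => absurd hlt (h w hw).not_gt

/-- The probability that the root of a fixed rooted graph belongs to the greedy independent set of
its past. -/
def rootOccupiedProb (X : RootedGraph) : ℝ :=
  (labelLaw X.V).real {σ | RootOccupied X σ}

theorem rootOccupiedProb_pos (X : RootedGraph) : 0 < rootOccupiedProb X := by
  let N : Finset X.V := (X.locallyFinite X.root).toFinset
  have hN : ∀ w, w ∈ N ↔ X.graph.Adj X.root w := fun w => Set.Finite.mem_toFinset _
  have hnodup : (N.toList ++ [X.root]).Nodup :=
    List.concat_eq_append ▸
      N.nodup_toList.concat fun h => X.graph.irrefl ((hN _).1 (Finset.mem_toList.1 h))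
  have hpos : 0 < labelLaw X.V {σ | (N.toList ++ [X.root]).Pairwise fun a b => σ b < σ a} := by
    rw [labelLaw_pairwise_gt hnodup]
    exact ENNReal.inv_pos.2 (ENNReal.natCast_ne_top _)
  refine ENNReal.toReal_pos (hpos.trans_le (measure_mono_ae ?_)).ne' (measure_ne_top _ _)
  filter_upwards [ae_injective_label X.V] with σ hσ hdec
  refine rootOccupied_of_lt hσ fun w hw => ?_
  exact (List.pairwise_append.1 hdec).2.2 w (Finset.mem_toList.2 ((hN w).2 hw)) _
    (List.mem_singleton_self _)

theorem abs_rootOccupiedProb_sub_le (X : RootedGraph) (r : ℕ) :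
    |rootOccupiedProb X - (occupiedEvent r).prob X.graph X.root| ≤
      (decreasingPathEvent r).prob X.graph X.root := by
  have hle : ∀ A B : Set (X.V → unitInterval), (∀ σ : X.V → unitInterval, Function.Injective σ →
      ¬ HasDecreasingPath X.graph σ r X.root → σ ∈ A → σ ∈ B) →
      (labelLaw X.V).real A ≤
        (labelLaw X.V).real B + (decreasingPathEvent r).prob X.graph X.root := fun A B hAB => by
    have hae : A ≤ᵐ[labelLaw X.V] (B ∪ {σ | HasDecreasingPath X.graph σ r X.root} : Set _) := by
      filter_upwards [ae_injective_label X.V] with σ hσ hA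
      exact or_iff_not_imp_right.2 fun hdec => hAB σ hσ hdec hA
    exact (ENNReal.toReal_mono (measure_ne_top _ _) (measure_mono_ae hae)).trans
      (measureReal_union_le _ _)
  rw [abs_sub_le_iff, sub_le_iff_le_add', sub_le_iff_le_add']
  exact ⟨hle _ _ fun σ hσ hdec => (rootOccupied_iff hσ hdec).1,
    hle _ _ fun σ hσ hdec => (rootOccupied_iff hσ hdec).2⟩

variable {U : Measure RootedGraph} [IsFiniteMeasure U]

theorem NonexplosiveGrowth.integrable_rootOccupiedProb (hU : NonexplosiveGrowth U) :
    Integrable rootOccupiedProb U := by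
  have hmeas : AEMeasurable rootOccupiedProb U := by
    refine aemeasurable_of_tendsto_metrizable_ae'
      (fun r => (occupiedEvent r).continuous_prob_root.aemeasurable) ?_
    filter_upwards [nonexplosiveGrowth_iff_infinitePastProb.1 hU] with X hX
    refine tendsto_iff_dist_tendsto_zero.2 (squeeze_zero (fun _ => dist_nonneg) (fun r => ?_)
      (hX ▸ tendsto_prob_decreasingPathEvent X))
    rw [dist_comm]
    exact abs_rootOccupiedProb_sub_le X r
  refine .of_bound hmeas.aestronglyMeasurable 1 (.of_forall fun X => ?_)
  rw [Real.norm_of_nonneg (rootOccupiedProb_pos X).le]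
  exact measureReal_le_one

theorem NonexplosiveGrowth.rootDensity_eq_integral (hU : NonexplosiveGrowth U) :
    rootDensity U = ∫ X, rootOccupiedProb X ∂U := by
  have hmeas : AEMeasurable (fun X : RootedGraph => labelLaw X.V {σ | RootOccupied X σ}) U :=
    hU.integrable_rootOccupiedProb.aemeasurable.ennreal_ofReal.congr
      (.of_forall fun X => ofReal_measureReal)
  exact (integral_toReal hmeas (.of_forall fun X => measure_lt_top _ _)).symm

theorem NonexplosiveGrowth.rootDensity_pos (hU : NonexplosiveGrowth U) [NeZero U] :
    0 < rootDensity U := by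
  have hsupport : Function.support rootOccupiedProb = Set.univ :=
    Set.eq_univ_of_forall fun X => (rootOccupiedProb_pos X).ne'
  rw [hU.rootDensity_eq_integral, integral_pos_iff_support_of_nonneg
    (fun X => (rootOccupiedProb_pos X).le) hU.integrable_rootOccupiedProb, hsupport]
  exact NeZero.pos _

theorem NonexplosiveGrowth.abs_rootDensity_sub_le (hU : NonexplosiveGrowth U) (r : ℕ) :
    |rootDensity U - (occupiedEvent r).limitProb U| ≤ (decreasingPathEvent r).limitProb U := by
  have hint := hU.integrable_rootOccupiedProb
  have hocc := (occupiedEvent r).integrable_prob_root U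
  rw [hU.rootDensity_eq_integral, LocalEvent.limitProb, ← integral_sub hint hocc]
  exact abs_integral_le_integral_abs.trans (integral_mono (hint.sub hocc).abs
    ((decreasingPathEvent r).integrable_prob_root U) fun X => abs_rootOccupiedProb_sub_le X r)

end RootDensity

section Convergence

theorem uniformOfFintype_greedyRatio_deviation_le (H : FinGraph) (r : ℕ) {U : Measure RootedGraph}
    [IsFiniteMeasure U] (hU : NonexplosiveGrowth U) {δ : ℝ}
    (hr : (decreasingPathEvent r).limitProb U ≤ δ) :
    (PMF.uniformOfFintype (Equiv.Perm (Fin (H.1 + 1)))).toOuterMeasure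
        {π | 4 * δ < |greedyRatio H π - rootDensity U|} ≤
      labelLaw _
          {σ | δ < |(decreasingPathEvent r).freq H σ - (decreasingPathEvent r).limitProb U|} +
        labelLaw _ {σ | δ < |(occupiedEvent r).freq H σ - (occupiedEvent r).limitProb U|} := by
  rw [uniformOfFintype_perm_apply]
  refine (measure_mono ?_).trans (measure_union_le _ _)
  rintro σ ⟨π, hπ : 4 * δ < _, hσ⟩
  by_contra hgood
  simp only [Set.mem_union, Set.mem_ofPred_eq, not_or, not_lt] at hgood
  obtain ⟨hdec, hocc⟩ := hgood
  refine hπ.not_ge ?_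
  calc |greedyRatio H π - rootDensity U|
      ≤ |greedyRatio H π - (occupiedEvent r).freq H σ| +
          |(occupiedEvent r).freq H σ - (occupiedEvent r).limitProb U| +
          |(occupiedEvent r).limitProb U - rootDensity U| := by
        exact (abs_sub_le _ _ _).trans (add_le_add_left (abs_sub_le _ _ _) _)
    _ ≤ (decreasingPathEvent r).freq H σ + δ + (decreasingPathEvent r).limitProb U := by
        gcongr
        · exact abs_greedyRatio_sub_freq_le H r hσ
        · exact abs_sub_comm _ (rootDensity U) ▸ hU.abs_rootDensity_sub_le r
    _ ≤ 4 * δ := by linarith [le_of_abs_le hdec]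

theorem greedyRatioLaw_apply (P : PMF FinGraph) (S : Set ℝ) :
    (greedyRatioLaw P).toOuterMeasure S = ∑' H, P H *
      (PMF.uniformOfFintype (Equiv.Perm (Fin (H.1 + 1)))).toOuterMeasure
        (greedyRatio H ⁻¹' S) := by
  simp only [greedyRatioLaw, PMF.toOuterMeasure_bind_apply, PMF.toOuterMeasure_map_apply]

theorem tendstoInProb_greedyRatio {G : ℕ → PMF FinGraph} {U : Measure RootedGraph}
    [IsFiniteMeasure U] (hord : OrderTendsto G) (hloc : ConvergesLocally G U)
    (hU : NonexplosiveGrowth U) :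
    TendstoInProb (fun n => greedyRatioLaw (G n)) id (rootDensity U) := by
  intro ε hε
  have hδ : 0 < ε / 4 := by positivity
  obtain ⟨r, hr⟩ := ((nonexplosiveGrowth_iff_tendsto.1 hU).eventually (ge_mem_nhds hδ)).exists
  have hlln : ∀ E : LocalEvent r, Tendsto (fun n => ∑' H, G n H *
      labelLaw _ {σ | ε / 4 < |E.freq H σ - E.limitProb U|}) atTop (𝓝 0) := fun E => by
    simpa only [ofReal_measureReal, ne_eq, measure_ne_top, not_false_eq_true] using
      (E.tendstoInProb_freq_deviation hord hloc hδ).tendsto_tsum_mul fun _ => measureReal_le_one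
  have hsum := (hlln (decreasingPathEvent r)).add (hlln (occupiedEvent r))
  rw [add_zero] at hsum
  refine tendsto_of_tendsto_of_tendsto_of_le_of_le tendsto_const_nhds hsum (fun _ => zero_le)
    fun n => ?_
  simp only [greedyRatioLaw_apply, ← ENNReal.tsum_add, ← mul_add]
  refine ENNReal.tsum_le_tsum fun H => mul_le_mul_right ?_ _
  have hle := uniformOfFintype_greedyRatio_deviation_le H r hU hr
  rwa [mul_div_cancel₀ ε four_ne_zero] at hle

end Convergence

end GreedyMIS

end

theorem theorem1p2 (G : ℕ → PMF GreedyMIS.FinGraph)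
    (U : Measure GreedyMIS.RootedGraph) [IsProbabilityMeasure U]
    (hord : GreedyMIS.OrderTendsto G)
    (hsfpg : GreedyMIS.SubfactorialPathGrowth G)
    (hloc : GreedyMIS.ConvergesLocally G U) :
    GreedyMIS.NonexplosiveGrowth U ∧
      ∀ ε : ℝ, 0 < ε →
        Tendsto (fun n => (GreedyMIS.greedyRatioLaw (G n)).toOuterMeasure
          {x : ℝ | |x - GreedyMIS.rootDensity U| ≤ ε * GreedyMIS.rootDensity U})
          atTop (𝓝 1) := by
  have hU := hsfpg.nonexplosiveGrowth hloc
  exact ⟨hU, fun ε hε =>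
    (GreedyMIS.tendstoInProb_greedyRatio hord hloc hU).tendsto_one (mul_pos hε hU.rootDensity_pos)⟩
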